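/- Let $K$ be a field of characteristic $0$ (for instance $\mathbb R$ or $\mathbb C$) and let $n\ge 2$, $m\ge 1$ be integers. Let $\mathfrak g=SL^{n,m}$ be the Lie superalgebra over $K$ whose even part $\mathfrak g_{\bar 0}$ has basis $X_1,\dots,X_n,T_1,T_2,T_3$, whose odd part $\mathfrak g_{\bar 1}$ has basis $Y_1,\dots,Y_m$, and whose only non-zero brackets of basis vectors, up to graded skew-symmetry, are $$[X_1,X_i]=X_{i+1}\ (2\le i\le n-1),\qquad [X_1,Y_j]=Y_{j+1}\ (1\le j\le m-1),$$ $$[T_1,X_i]=iX_i\ (1\le i\le n),\qquad [T_1,Y_j]=jY_j\ (1\le j\le m),$$ $$[T_2,X_i]=X_i\ (2\le i\le n),\qquad [T_3,Y_j]=Y_j\ (1\le j\le m).$$ (This is the maximal-dimensional solvable Lie superalgebra whose nilradical is the model filiform Lie superalgebra $L^{n,m}$, the span of the $X_i$ and $Y_j$.) For a Lie superalgebra $\mathfrak g$ let $C^q=\bigoplus_{q_0+q_1=q}\mathrm{Hom}(\wedge^{q_0}\mathfrak g_{\bar 0}\otimes S^{q_1}\mathfrak g_{\bar 1},\mathfrak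 g)$ be the superspace of $q$-cochains with coefficients in the adjoint module; a component with $q_1$ odd arguments has parity $p$ if it takes values in $\mathfrak g_r$ with $q_1+r\equiv p \pmod 2$. The differential $d$ is given, for $f\in C^1$, $c\in C^2$, $g,g',g_i\in\mathfrak g_{\bar 0}$ and $h,h',h_i\in\mathfrak g_{\bar 1}$, by $$df(g,g')=f[g,g']-[g,f g']+[g',f g],\quad df(g,h)=f[g,h]-[g,f h]+[h,f g],\quad df(h,h')=f[h,h']-[h,f h']-[h',f h],$$ $$dc(g_1,g_2,g_3)=c([g_1,g_2],g_3)-c([g_1,g_3],g_2)+c([g_2,g_3],g_1)-[g_1,c(g_2,g_3)]+[g_2,c(g_1,g_3)]-[g_3,c(g_1,g_2)],$$ $$dc(g_1,g_2,h)=c([g_1,g_2],h)+c(g_2,[g_1,h])-c(g_1,[g_2,h])-[g_1,c(g_2,h)]+[g_2,c(g_1,h)]-[h,c(g_1,g_2)],$$ $$dc(g,h_1,h_2)=c([g,h_1],h_2)+c([g,h_2],h_1)+c([h_1,h_2],g)-[g,c(h_1,h_2)]+[h_1,c(g,h_2)]+[h_2,c(g,h_1)],$$ $$dc(h_1,h_2,h_3)=c([h_1,h_2],h_3)+c([h_1,h_3],h_2)+c([h_2,h_3],h_1)-[h_1,c(h_2,h_3)]-[h_2,c(h_1,h_3)]-[h_3,c(h_1,h_2)],$$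 where $c(g,g')$, $c(g,h)$ and $c(h,h')$ denote the three components of $c$. Put $H^2(\mathfrak g;\mathfrak g)=Z^2/B^2$ with $Z^2=\ker(d|_{C^2})$, $B^2=d(C^1)$, and let $H^2_p(\mathfrak g;\mathfrak g)=Z^2_p/B^2_p$ be the same quotient formed from the cochains of parity $p\in\{\bar 0,\bar 1\}$. Then $SL^{n,m}$ is (cohomologically) rigid, that is, $$\dim H^2(SL^{n,m};SL^{n,m})=\dim H^2_{\bar 0}(SL^{n,m};SL^{n,m})+\dim H^2_{\bar 1}(SL^{n,m};SL^{n,m})=0.$$ -/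

import Mathlib

/-- The quotient `Z / B` of a subspace `Z` by a subspace `B` (by `Z ∩ B` if `B` is not contained
in `Z`). -/
def SubQuot {K M : Type*} [Field K] [AddCommGroup M] [Module K M] (Z B : Submodule K M) :
    Type _ := Z ⧸ B.submoduleOf Z

instance {K M : Type*} [Field K] [AddCommGroup M] [Module K M] (Z B : Submodule K M) :
    AddCommGroup (SubQuot Z B) := inferInstanceAs (AddCommGroup (Z ⧸ B.submoduleOf Z))

instance {K M : Type*} [Field K] [AddCommGroup M] [Module K M] (Z B : Submodule K M) :
    Module K (SubQuot Z B) := inferInstanceAs (Module K (Z ⧸ B.submoduleOf Z))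

/-- A Lie superalgebra structure on the `K`-vector space `V`: a `ℤ/2`-grading
`V = V₀ ⊕ V₁` and an even bilinear bracket which is graded skew-symmetric and satisfies
the graded Jacobi identity on homogeneous elements. -/
structure LieSuperalgebra (K V : Type*) [Field K] [AddCommGroup V] [Module K V] where
  /-- the even part `part 0` and the odd part `part 1` -/
  part : ZMod 2 → Submodule K V
  isCompl : IsCompl (part 0) (part 1)
  bracket : V →ₗ[K] V →ₗ[K] V
  bracket_mem : ∀ (α β : ZMod 2) (x y : V), x ∈ part α → y ∈ part β →
    bracket x y ∈ part (α + β)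
  skew : ∀ (α β : ZMod 2) (x y : V), x ∈ part α → y ∈ part β →
    bracket x y = -((-1 : K) ^ (α.val * β.val) • bracket y x)
  jacobi : ∀ (α β γ : ZMod 2) (x y z : V), x ∈ part α → y ∈ part β → z ∈ part γ →
    (-1 : K) ^ (γ.val * α.val) • bracket x (bracket y z)
      + (-1 : K) ^ (α.val * β.val) • bracket y (bracket z x)
      + (-1 : K) ^ (β.val * γ.val) • bracket z (bracket x y) = 0

namespace LieSuperalgebra

variable {K V : Type*} [Field K] [AddCommGroup V] [Module K V] (L : LieSuperalgebra K V)

/-- The even part. -/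
abbrev Even : Type _ := L.part 0

/-- The odd part. -/
abbrev Odd : Type _ := L.part 1

/-- The bracket of two even elements, as an even element. -/
def br00 (g g' : L.Even) : L.Even := ⟨L.bracket g g', L.bracket_mem 0 0 _ _ g.2 g'.2⟩

/-- The bracket of an even and an odd element, as an odd element. -/
def br01 (g : L.Even) (h : L.Odd) : L.Odd := ⟨L.bracket g h, L.bracket_mem 0 1 _ _ g.2 h.2⟩

/-- The bracket of two odd elements, as an even element. -/
def br11 (h h' : L.Odd) : L.Even := ⟨L.bracket h h', L.bracket_mem 1 1 _ _ h.2 h'.2⟩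

/-- The space `C¹ = Hom(g₀, g) ⊕ Hom(g₁, g)` of 1-cochains with adjoint coefficients. -/
abbrev Cochain1 : Type _ := (L.Even →ₗ[K] V) × (L.Odd →ₗ[K] V)

/-- Triples of bilinear maps `g₀ × g₀ → g`, `g₀ × g₁ → g`, `g₁ × g₁ → g`, without any symmetry
condition. -/
abbrev PreCochain2 : Type _ :=
  (L.Even →ₗ[K] L.Even →ₗ[K] V) × (L.Even →ₗ[K] L.Odd →ₗ[K] V) × (L.Odd →ₗ[K] L.Odd →ₗ[K] V)

/-- Functions on the argument triples of the types `g₀g₀g₀`, `g₀g₀g₁`, `g₀g₁g₁`, `g₁g₁g₁`: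
a space containing the 3-cochains. -/
abbrev PreCochain3 : Type _ :=
  (L.Even → L.Even → L.Even → V) × (L.Even → L.Even → L.Odd → V) ×
    (L.Even → L.Odd → L.Odd → V) × (L.Odd → L.Odd → L.Odd → V)

/-- The space `C² = Hom(⋀² g₀, g) ⊕ Hom(g₀ ⊗ g₁, g) ⊕ Hom(S² g₁, g)` of 2-cochains with adjoint
coefficients. -/
def C2 : Submodule K L.PreCochain2 where
  carrier := {c | (∀ g, c.1 g g = 0) ∧ ∀ h h', c.2.2 h h' = c.2.2 h' h}
  zero_mem' := by simp
  add_mem' := by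
    rintro a b ⟨ha, ha'⟩ ⟨hb, hb'⟩
    refine ⟨fun g => ?_, fun h h' => ?_⟩
    · simp [ha g, hb g]
    · simp [ha' h h', hb' h h']
  smul_mem' := by
    rintro r a ⟨ha, ha'⟩
    refine ⟨fun g => ?_, fun h h' => ?_⟩
    · simp [ha g]
    · simp [ha' h h']

/-- The 1-cochains of parity `p`: a component on `q₁` odd arguments takes values in the part of
degree `p + q₁`. -/
def C1p (p : ZMod 2) : Submodule K L.Cochain1 where
  carrier := {f | (∀ g, f.1 g ∈ L.part p) ∧ ∀ h, f.2 h ∈ L.part (p + 1)}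
  zero_mem' := by simp
  add_mem' := by
    rintro a b ⟨ha, ha'⟩ ⟨hb, hb'⟩
    exact ⟨fun g => add_mem (ha g) (hb g), fun h => add_mem (ha' h) (hb' h)⟩
  smul_mem' := by
    rintro r a ⟨ha, ha'⟩
    exact ⟨fun g => Submodule.smul_mem _ r (ha g), fun h => Submodule.smul_mem _ r (ha' h)⟩

/-- The 2-cochains of parity `p`: a component on `q₁` odd arguments takes values in the part of
degree `p + q₁`. -/
def C2p (p : ZMod 2) : Submodule K L.PreCochain2 where
  carrier := {c | c ∈ L.C2 ∧ (∀ g g', c.1 g g' ∈ L.part p) ∧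
    (∀ g h, c.2.1 g h ∈ L.part (p + 1)) ∧ ∀ h h', c.2.2 h h' ∈ L.part p}
  zero_mem' := ⟨zero_mem _, by simp⟩
  add_mem' := by
    rintro a b ⟨hA, ha, ha', ha''⟩ ⟨hB, hb, hb', hb''⟩
    exact ⟨add_mem hA hB, fun _ _ => add_mem (ha _ _) (hb _ _),
      fun _ _ => add_mem (ha' _ _) (hb' _ _), fun _ _ => add_mem (ha'' _ _) (hb'' _ _)⟩
  smul_mem' := by
    rintro r a ⟨hA, ha, ha', ha''⟩
    exact ⟨Submodule.smul_mem _ r hA, fun _ _ => Submodule.smul_mem _ r (ha _ _),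
      fun _ _ => Submodule.smul_mem _ r (ha' _ _), fun _ _ => Submodule.smul_mem _ r (ha'' _ _)⟩

/-- The differential `C¹ → C²`:
`df(g, g') = f[g,g'] - [g, f g'] + [g', f g]`,
`df(g, h) = f[g,h] - [g, f h] + [h, f g]`,
`df(h, h') = f[h,h'] - [h, f h'] - [h', f h]`
for even `g, g'` and odd `h, h'`. -/
def d1 : L.Cochain1 →ₗ[K] L.PreCochain2 where
  toFun f :=
    (LinearMap.mk₂ K
        (fun g g' => f.1 (L.br00 g g') - L.bracket g (f.1 g') + L.bracket g' (f.1 g))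
        (fun a b c => by
          rw [show L.br00 (a + b) c = L.br00 a c + L.br00 b c from Subtype.ext (by simp [br00])]
          simp; abel)
        (fun r a c => by
          rw [show L.br00 (r • a) c = r • L.br00 a c from Subtype.ext (by simp [br00])]
          simp [smul_sub, smul_add])
        (fun a b c => by
          rw [show L.br00 a (b + c) = L.br00 a b + L.br00 a c from Subtype.ext (by simp [br00])]
          simp; abel)
        (fun r a c => by
          rw [show L.br00 a (r • c) = r • L.br00 a c from Subtype.ext (by simp [br00])]
          simp [smul_sub, smul_add]),
      LinearMap.mk₂ K
        (fun g h => f.2 (L.br01 g h) - L.bracket g (f.2 h) + L.bracket h (f.1 g))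
        (fun a b c => by
          rw [show L.br01 (a + b) c = L.br01 a c + L.br01 b c from Subtype.ext (by simp [br01])]
          simp; abel)
        (fun r a c => by
          rw [show L.br01 (r • a) c = r • L.br01 a c from Subtype.ext (by simp [br01])]
          simp [smul_sub, smul_add])
        (fun a b c => by
          rw [show L.br01 a (b + c) = L.br01 a b + L.br01 a c from Subtype.ext (by simp [br01])]
          simp; abel)
        (fun r a c => by
          rw [show L.br01 a (r • c) = r • L.br01 a c from Subtype.ext (by simp [br01])]
          simp [smul_sub, smul_add]),
      LinearMap.mk₂ K
        (fun h h' => f.1 (L.br11 h h') - L.bracket h (f.2 h') - L.bracket h' (f.2 h))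
        (fun a b c => by
          rw [show L.br11 (a + b) c = L.br11 a c + L.br11 b c from Subtype.ext (by simp [br11])]
          simp; abel)
        (fun r a c => by
          rw [show L.br11 (r • a) c = r • L.br11 a c from Subtype.ext (by simp [br11])]
          simp [smul_sub])
        (fun a b c => by
          rw [show L.br11 a (b + c) = L.br11 a b + L.br11 a c from Subtype.ext (by simp [br11])]
          simp; abel)
        (fun r a c => by
          rw [show L.br11 a (r • c) = r • L.br11 a c from Subtype.ext (by simp [br11])]
          simp [smul_sub]))
  map_add' f f' := by
    refine Prod.ext ?_ (Prod.ext ?_ ?_) <;>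
    · refine LinearMap.ext₂ fun a b => ?_
      simp; abel
  map_smul' r f := by
    refine Prod.ext ?_ (Prod.ext ?_ ?_) <;>
    · refine LinearMap.ext₂ fun a b => ?_
      simp [smul_sub, smul_add]

/-- The differential on `C²`, for even `g, gᵢ` and odd `h, hᵢ`:
`dc(g₁, g₂, g₃) = c([g₁,g₂], g₃) - c([g₁,g₃], g₂) + c([g₂,g₃], g₁)
  - [g₁, c(g₂,g₃)] + [g₂, c(g₁,g₃)] - [g₃, c(g₁,g₂)]`,
`dc(g₁, g₂, h) = c([g₁,g₂], h) + c(g₂, [g₁,h]) - c(g₁, [g₂,h])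
  - [g₁, c(g₂,h)] + [g₂, c(g₁,h)] - [h, c(g₁,g₂)]`,
`dc(g, h₁, h₂) = c([g,h₁], h₂) + c([g,h₂], h₁) + c([h₁,h₂], g)
  - [g, c(h₁,h₂)] + [h₁, c(g,h₂)] + [h₂, c(g,h₁)]`,
`dc(h₁, h₂, h₃) = c([h₁,h₂], h₃) + c([h₁,h₃], h₂) + c([h₂,h₃], h₁)
  - [h₁, c(h₂,h₃)] - [h₂, c(h₁,h₃)] - [h₃, c(h₁,h₂)]`. -/
def d2 : L.PreCochain2 →ₗ[K] L.PreCochain3 where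
  toFun c :=
    (fun g₁ g₂ g₃ => c.1 (L.br00 g₁ g₂) g₃ - c.1 (L.br00 g₁ g₃) g₂ + c.1 (L.br00 g₂ g₃) g₁
        - L.bracket g₁ (c.1 g₂ g₃) + L.bracket g₂ (c.1 g₁ g₃) - L.bracket g₃ (c.1 g₁ g₂),
      fun g₁ g₂ h => c.2.1 (L.br00 g₁ g₂) h + c.2.1 g₂ (L.br01 g₁ h) - c.2.1 g₁ (L.br01 g₂ h)
        - L.bracket g₁ (c.2.1 g₂ h) + L.bracket g₂ (c.2.1 g₁ h) - L.bracket h (c.1 g₁ g₂),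
      fun g h₁ h₂ => c.2.2 (L.br01 g h₁) h₂ + c.2.2 (L.br01 g h₂) h₁ + c.1 (L.br11 h₁ h₂) g
        - L.bracket g (c.2.2 h₁ h₂) + L.bracket h₁ (c.2.1 g h₂) + L.bracket h₂ (c.2.1 g h₁),
      fun h₁ h₂ h₃ =>
        c.2.1 (L.br11 h₁ h₂) h₃ + c.2.1 (L.br11 h₁ h₃) h₂ + c.2.1 (L.br11 h₂ h₃) h₁
        - L.bracket h₁ (c.2.2 h₂ h₃) - L.bracket h₂ (c.2.2 h₁ h₃) - L.bracket h₃ (c.2.2 h₁ h₂))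
  map_add' c c' := by
    refine Prod.ext ?_ (Prod.ext ?_ (Prod.ext ?_ ?_)) <;>
    · funext x y z
      simp; abel
  map_smul' r c := by
    refine Prod.ext ?_ (Prod.ext ?_ (Prod.ext ?_ ?_)) <;>
    · funext x y z
      simp [smul_sub, smul_add]

/-- The 2-cocycles. -/
def Z2 : Submodule K L.PreCochain2 := L.C2 ⊓ LinearMap.ker L.d2

/-- The 2-coboundaries. -/
def B2 : Submodule K L.PreCochain2 := LinearMap.range L.d1

/-- The 2-cocycles of parity `p`. -/
def Z2p (p : ZMod 2) : Submodule K L.PreCochain2 := L.C2p p ⊓ LinearMap.ker L.d2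

/-- The 2-coboundaries of parity `p`. -/
def B2p (p : ZMod 2) : Submodule K L.PreCochain2 := (L.C1p p).map L.d1

section facts

theorem skew00 (x y : L.Even) : L.bracket x y = -L.bracket y x := by
  simpa using L.skew 0 0 x y x.2 y.2

theorem skew11 (x y : L.Odd) : L.bracket x y = L.bracket y x := by
  simpa [ZMod.val_one] using L.skew 1 1 x y x.2 y.2

theorem homogeneous_induction {p : V → Prop} (z : V) (add : ∀ x y, p x → p y → p (x + y))
    (h0 : ∀ z ∈ L.part 0, p z) (h1 : ∀ z ∈ L.part 1, p z) : p z := by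
  obtain ⟨a, ha, b, hb, rfl⟩ := Submodule.mem_sup.1
    (show z ∈ L.part 0 ⊔ L.part 1 from L.isCompl.sup_eq_top ▸ Submodule.mem_top)
  exact add _ _ (h0 a ha) (h1 b hb)

/-- The graded Jacobi identity, solved for the first term. -/
theorem jacobi' (α β : ZMod 2) (x y z : V) (hx : x ∈ L.part α) (hy : y ∈ L.part β) :
    L.bracket x (L.bracket y z) = L.bracket (L.bracket x y) z
      + (-1 : K) ^ (α.val * β.val) • L.bracket y (L.bracket x z) := by
  have h2 : ∀ α : ZMod 2, α = 0 ∨ α = 1 := by decide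
  have v1 : (1 : ZMod 2).val = 1 := rfl
  have v0 : (0 : ZMod 2).val = 0 := rfl
  have main : ∀ γ : ZMod 2, ∀ z ∈ L.part γ, L.bracket x (L.bracket y z)
      = L.bracket (L.bracket x y) z
        + (-1 : K) ^ (α.val * β.val) • L.bracket y (L.bracket x z) := by
    intro γ z hz
    have hJ := L.jacobi α β γ x y z hx hy hz
    have hs := L.skew γ α z x hz hx
    have ht := L.skew γ (α + β) z (L.bracket x y) hz (L.bracket_mem _ _ _ _ hx hy)
    rw [hs, ht] at hJ
    rcases h2 α with rfl | rfl <;> rcases h2 β with rfl | rfl <;> rcases h2 γ with rfl | rfl <;>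
      simp [v1, show (1 : ZMod 2) + 1 = 0 from rfl] at hJ ⊢ <;>
      first
        | (rw [← sub_eq_zero, ← hJ]; abel; done)
        | (rw [← sub_eq_zero, ← neg_eq_zero, ← hJ]; abel)
  refine L.homogeneous_induction z (fun a b ha hb => ?_) (main 0) (main 1)
  simp only [map_add, ha, hb, smul_add]; abel

theorem ad00 (x y : L.Even) (z : V) : L.bracket x (L.bracket y z)
    = L.bracket (L.bracket x y) z + L.bracket y (L.bracket x z) := by
  simpa using L.jacobi' 0 0 x y z x.2 y.2

theorem ad01 (x : L.Even) (y : L.Odd) (z : V) : L.bracket x (L.bracket y z)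
    = L.bracket (L.bracket x y) z + L.bracket y (L.bracket x z) := by
  simpa using L.jacobi' 0 1 x y z x.2 y.2

theorem ad11 (x y : L.Odd) (z : V) : L.bracket x (L.bracket y z)
    = L.bracket (L.bracket x y) z - L.bracket y (L.bracket x z) := by
  simpa [ZMod.val_one, sub_eq_add_neg] using L.jacobi' 1 1 x y z x.2 y.2

end facts

/-- Coboundaries are cocycles. -/
theorem B2_le_Z2 (h2 : (2 : K) ≠ 0) : L.B2 ≤ L.Z2 := by
  have val00 : ∀ x y : L.Even, ((L.br00 x y : L.Even) : V) = L.bracket x y := fun _ _ => rfl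
  have val01 : ∀ (x : L.Even) (y : L.Odd), ((L.br01 x y : L.Odd) : V) = L.bracket x y :=
    fun _ _ => rfl
  have val11 : ∀ x y : L.Odd, ((L.br11 x y : L.Even) : V) = L.bracket x y := fun _ _ => rfl
  rintro _ ⟨f, rfl⟩
  refine ⟨⟨fun g => ?_, fun h h' => ?_⟩, ?_⟩
  · have : L.br00 g g = 0 := by
      refine Subtype.ext ((smul_right_injective V h2) ?_)
      have := L.skew00 g g
      simp only [val00, ZeroMemClass.coe_zero, smul_zero, two_smul]
      exact eq_neg_iff_add_eq_zero.1 this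
    simp [d1, this]
  · have : L.br11 h h' = L.br11 h' h := Subtype.ext (L.skew11 h h')
    simp only [d1, LinearMap.coe_mk, AddHom.coe_mk, LinearMap.mk₂_apply, this]
    abel
  · change L.d2 (L.d1 f) = 0
    refine Prod.ext ?_ (Prod.ext ?_ (Prod.ext ?_ ?_)) <;> funext x y z <;>
      simp only [d1, d2, LinearMap.coe_mk, AddHom.coe_mk, LinearMap.mk₂_apply, val00, val01, val11,
        map_add, map_sub, Prod.fst_zero, Prod.snd_zero, Pi.zero_apply]
    · have hJ : L.br00 (L.br00 x y) z - L.br00 (L.br00 x z) y + L.br00 (L.br00 y z) x = 0 := by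
        refine Subtype.ext ?_
        have := L.ad00 x y z
        have a1 := L.skew00 (L.br00 x z) y
        have a2 := L.skew00 (L.br00 y z) x
        simp only [val00] at a1 a2
        simp [val00, a1, a2, this]
      have hf := congrArg f.1 hJ
      simp only [map_add, map_sub, map_zero] at hf
      rw [L.ad00 x y, L.ad00 x z, L.ad00 y z, ← hf]; abel
    · have hJ : L.br01 (L.br00 x y) z + L.br01 y (L.br01 x z) - L.br01 x (L.br01 y z) = 0 := by
        refine Subtype.ext ?_
        have := L.ad00 x y z
        simp [val00, val01, this]
      have hf := congrArg f.2 hJ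
      simp only [map_add, map_sub, map_zero] at hf
      rw [L.ad00 x y, L.ad01 x z, L.ad01 y z, ← hf]; abel
    · have hJ : L.br11 (L.br01 x y) z + L.br11 (L.br01 x z) y + L.br00 (L.br11 y z) x = 0 := by
        refine Subtype.ext ?_
        have := L.ad01 x y z
        have a1 := L.skew11 (L.br01 x z) y
        have a2 := L.skew00 (L.br11 y z) x
        simp only [val01, val11] at a1 a2
        simp [val00, val01, val11, a1, a2, this]
      have hf := congrArg f.1 hJ
      simp only [map_add, map_zero] at hf
      rw [L.ad01 x y, L.ad01 x z, L.ad11 y z, ← hf]; abel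
    · have e : ∀ (x : L.Even) (y : L.Odd), L.bracket y x = -L.bracket x y := fun x y => by
        simpa using L.skew 1 0 y x y.2 x.2
      have hJ : L.br01 (L.br11 x y) z + L.br01 (L.br11 x z) y + L.br01 (L.br11 y z) x = 0 := by
        refine Subtype.ext ?_
        have := L.ad11 x y z
        have a1 := e (L.br11 x z) y
        have a2 := e (L.br11 y z) x
        simp only [val11] at a1 a2
        rw [a1, a2] at this
        simp only [val01, val11, Submodule.coe_add, ZeroMemClass.coe_zero]
        rw [eq_comm, ← sub_eq_zero] at this
        rw [← this]; abel
      have hf := congrArg f.2 hJ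
      simp only [map_add, map_zero] at hf
      rw [L.ad11 x y, L.ad11 x z, L.ad11 y z, ← hf]; abel

/-- Coboundaries of parity `p` are cocycles of parity `p`. -/
theorem B2p_le_Z2p (h2 : (2 : K) ≠ 0) (p : ZMod 2) : L.B2p p ≤ L.Z2p p := by
  rintro _ ⟨f, ⟨hf, hf'⟩, rfl⟩
  have hZ := L.B2_le_Z2 h2 ⟨f, rfl⟩
  have h11 : (1 : ZMod 2) + (p + 1) = p :=
    (show ∀ p : ZMod 2, 1 + (p + 1) = p by decide) p
  refine ⟨⟨hZ.1, fun g g' => ?_, fun g h => ?_, fun h h' => ?_⟩, hZ.2⟩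
  · have a1 := L.bracket_mem 0 p _ _ g.2 (hf g')
    have a2 := L.bracket_mem 0 p _ _ g'.2 (hf g)
    rw [zero_add] at a1 a2
    exact add_mem (sub_mem (hf _) a1) a2
  · have a1 := L.bracket_mem 0 _ _ _ g.2 (hf' h)
    have a2 := L.bracket_mem 1 _ _ _ h.2 (hf g)
    rw [zero_add] at a1
    rw [add_comm] at a2
    exact add_mem (sub_mem (hf' _) a1) a2
  · have a1 := L.bracket_mem 1 _ _ _ h.2 (hf' h')
    have a2 := L.bracket_mem 1 _ _ _ h'.2 (hf' h)
    rw [h11] at a1 a2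
    exact sub_mem (sub_mem (hf _) a1) a2

/-- The second cohomology `H²(g; g) = Z² / B²`. -/
abbrev H2 : Type _ := SubQuot L.Z2 L.B2

/-- The part `H²_p(g; g) = Z²_p / B²_p` of parity `p` of the second cohomology. -/
abbrev H2p (p : ZMod 2) : Type _ := SubQuot (L.Z2p p) (L.B2p p)

end LieSuperalgebra

/-- The index set of the basis `X₁, …, Xₙ, T₁, T₂, T₃, Y₁, …, Yₘ`; `X i` and `Y j` stand for
`X_{i+1}` and `Y_{j+1}`. -/
inductive SLIndex (n m : ℕ) : Type
  | X (i : Fin n)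
  | T1
  | T2
  | T3
  | Y (j : Fin m)

namespace SL

/-- The parity of a basis vector. -/
def parity {n m : ℕ} : SLIndex n m → ZMod 2
  | .Y _ => 1
  | _ => 0

variable (K : Type*) [Field K] (n m : ℕ)

/-- The underlying vector space of `SL^{n,m}`. -/
abbrev Carrier : Type _ := SLIndex n m →₀ K

/-- The vector `X_k` for `1 ≤ k ≤ n`, and `0` for any other `k`. -/
noncomputable def vecX (k : ℕ) : Carrier K n m :=
  if h : 1 ≤ k ∧ k ≤ n then Finsupp.single (.X ⟨k - 1, by omega⟩) 1 else 0

/-- The vector `Y_k` for `1 ≤ k ≤ m`, and `0` for any other `k`. -/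
noncomputable def vecY (k : ℕ) : Carrier K n m :=
  if h : 1 ≤ k ∧ k ≤ m then Finsupp.single (.Y ⟨k - 1, by omega⟩) 1 else 0

/-- The list of the defining brackets: `[X₁, X_i] = X_{i+1}` for `2 ≤ i ≤ n - 1`,
`[X₁, Y_j] = Y_{j+1}` for `1 ≤ j ≤ m - 1`, `[T₁, X_i] = i X_i`, `[T₁, Y_j] = j Y_j`,
`[T₂, X_i] = X_i` for `2 ≤ i`, `[T₃, Y_j] = Y_j`. -/
noncomputable def table : SLIndex n m → SLIndex n m → Carrier K n m
  | .X a, .X i => if a.val + 1 = 1 ∧ 2 ≤ i.val + 1 then vecX K n m (i.val + 1 + 1) else 0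
  | .X a, .Y j => if a.val + 1 = 1 then vecY K n m (j.val + 1 + 1) else 0
  | .T1, .X i => ((i.val + 1 : ℕ) : K) • vecX K n m (i.val + 1)
  | .T1, .Y j => ((j.val + 1 : ℕ) : K) • vecY K n m (j.val + 1)
  | .T2, .X i => if 2 ≤ i.val + 1 then vecX K n m (i.val + 1) else 0
  | .T3, .Y j => vecY K n m (j.val + 1)
  | _, _ => 0

/-- The bracket of `SL^{n,m}`: the brackets in the list, their opposites (no bracket of two odd
vectors is listed, so that graded skew-symmetry is skew-symmetry here), and no others. -/
noncomputable def bracket : Carrier K n m →ₗ[K] Carrier K n m →ₗ[K] Carrier K n m :=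
  Finsupp.linearCombination K fun a =>
    Finsupp.linearCombination K fun b => table K n m a b - table K n m b a

/-- The part of degree `α`: the span of the basis vectors of parity `α`. -/
noncomputable def part (α : ZMod 2) : Submodule K (Carrier K n m) :=
  Finsupp.supported K K {a | parity a = α}

section facts

variable {K n m}

theorem bracket_single (a b : SLIndex n m) :
    bracket K n m (Finsupp.single a 1) (Finsupp.single b 1)
      = table K n m a b - table K n m b a := by
  simp [bracket]

theorem single_X (i : Fin n) :
    (Finsupp.single (.X i) 1 : Carrier K n m) = vecX K n m (i.val + 1) := by
  simp [vecX, Nat.succ_le_of_lt i.2]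

theorem single_Y (j : Fin m) :
    (Finsupp.single (.Y j) 1 : Carrier K n m) = vecY K n m (j.val + 1) := by
  simp [vecY, Nat.succ_le_of_lt j.2]

theorem bracket_X_X (a b : ℕ) : bracket K n m (vecX K n m a) (vecX K n m b)
    = (if a = 1 ∧ 2 ≤ b then vecX K n m (b + 1) else 0)
      - (if b = 1 ∧ 2 ≤ a then vecX K n m (a + 1) else 0) := by
  by_cases ha : 1 ≤ a ∧ a ≤ n <;> by_cases hb : 1 ≤ b ∧ b ≤ n
  · obtain ⟨a, rfl⟩ : ∃ k, a = k + 1 := ⟨a - 1, by omega⟩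
    obtain ⟨b, rfl⟩ : ∃ k, b = k + 1 := ⟨b - 1, by omega⟩
    have h1 := single_X (K := K) (m := m) (⟨a, by omega⟩ : Fin n)
    have h2 := single_X (K := K) (m := m) (⟨b, by omega⟩ : Fin n)
    simp only at h1 h2
    rw [← h1, ← h2, bracket_single]
    simp [table]
  all_goals
    simp only [vecX]
    split_ifs <;> first | omega | simp

theorem bracket_X_Y (a b : ℕ) (hb : 1 ≤ b) : bracket K n m (vecX K n m a) (vecY K n m b)
    = if a = 1 ∧ 1 ≤ n then vecY K n m (b + 1) else 0 := by
  by_cases ha : 1 ≤ a ∧ a ≤ n <;> by_cases hb : 1 ≤ b ∧ b ≤ m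
  · obtain ⟨a, rfl⟩ : ∃ k, a = k + 1 := ⟨a - 1, by omega⟩
    obtain ⟨b, rfl⟩ : ∃ k, b = k + 1 := ⟨b - 1, by omega⟩
    have h1 := single_X (K := K) (m := m) (⟨a, by omega⟩ : Fin n)
    have h2 := single_Y (K := K) (n := n) (⟨b, by omega⟩ : Fin m)
    simp only at h1 h2
    rw [← h1, ← h2, bracket_single]
    have : 1 ≤ n := by omega
    simp [table, this]
  all_goals
    simp only [vecX, vecY]
    split_ifs <;> first | omega | simp

theorem bracket_T1_X (b : ℕ) : bracket K n m (Finsupp.single .T1 1) (vecX K n m b)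
    = (b : K) • vecX K n m b := by
  by_cases hb : 1 ≤ b ∧ b ≤ n
  · obtain ⟨b, rfl⟩ : ∃ k, b = k + 1 := ⟨b - 1, by omega⟩
    have h2 := single_X (K := K) (m := m) (⟨b, by omega⟩ : Fin n)
    simp only at h2
    rw [← h2, bracket_single]
    simp [table, h2]
  · simp [vecX, hb]

theorem bracket_T1_Y (b : ℕ) : bracket K n m (Finsupp.single .T1 1) (vecY K n m b)
    = (b : K) • vecY K n m b := by
  by_cases hb : 1 ≤ b ∧ b ≤ m
  · obtain ⟨b, rfl⟩ : ∃ k, b = k + 1 := ⟨b - 1, by omega⟩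
    have h2 := single_Y (K := K) (n := n) (⟨b, by omega⟩ : Fin m)
    simp only at h2
    rw [← h2, bracket_single]
    simp [table, h2]
  · simp [vecY, hb]

theorem bracket_T2_X (b : ℕ) : bracket K n m (Finsupp.single .T2 1) (vecX K n m b)
    = if 2 ≤ b then vecX K n m b else 0 := by
  by_cases hb : 1 ≤ b ∧ b ≤ n
  · obtain ⟨b, rfl⟩ : ∃ k, b = k + 1 := ⟨b - 1, by omega⟩
    have h2 := single_X (K := K) (m := m) (⟨b, by omega⟩ : Fin n)
    simp only at h2
    rw [← h2, bracket_single]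
    simp [table, h2]
  · simp [vecX, hb]

theorem bracket_T2_Y (b : ℕ) : bracket K n m (Finsupp.single .T2 1) (vecY K n m b) = 0 := by
  by_cases hb : 1 ≤ b ∧ b ≤ m
  · obtain ⟨b, rfl⟩ : ∃ k, b = k + 1 := ⟨b - 1, by omega⟩
    have h2 := single_Y (K := K) (n := n) (⟨b, by omega⟩ : Fin m)
    simp only at h2
    rw [← h2, bracket_single]
    simp [table]
  · simp [vecY, hb]

theorem bracket_T3_X (b : ℕ) : bracket K n m (Finsupp.single .T3 1) (vecX K n m b) = 0 := by
  by_cases hb : 1 ≤ b ∧ b ≤ n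
  · obtain ⟨b, rfl⟩ : ∃ k, b = k + 1 := ⟨b - 1, by omega⟩
    have h2 := single_X (K := K) (m := m) (⟨b, by omega⟩ : Fin n)
    simp only at h2
    rw [← h2, bracket_single]
    simp [table]
  · simp [vecX, hb]

theorem bracket_T3_Y (b : ℕ) : bracket K n m (Finsupp.single .T3 1) (vecY K n m b)
    = vecY K n m b := by
  by_cases hb : 1 ≤ b ∧ b ≤ m
  · obtain ⟨b, rfl⟩ : ∃ k, b = k + 1 := ⟨b - 1, by omega⟩
    have h2 := single_Y (K := K) (n := n) (⟨b, by omega⟩ : Fin m)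
    simp only at h2
    rw [← h2, bracket_single]
    simp [table, h2]
  · simp [vecY, hb]

theorem bracket_Y_Y (a b : ℕ) : bracket K n m (vecY K n m a) (vecY K n m b) = 0 := by
  simp only [vecY]
  split_ifs
  · rw [bracket_single]; simp [table]
  all_goals simp

/-- A linear property of vectors can be checked on the basis. -/
theorem carrier_induction {p : Carrier K n m → Prop} (x : Carrier K n m)
    (zero : p 0) (add : ∀ x y, p x → p y → p (x + y)) (smul : ∀ (r : K) x, p x → p (r • x))
    (hX : ∀ k, 1 ≤ k → p (vecX K n m k)) (hY : ∀ k, 1 ≤ k → p (vecY K n m k))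
    (hT : ∀ a : SLIndex n m, a = .T1 ∨ a = .T2 ∨ a = .T3 → p (Finsupp.single a 1)) : p x := by
  induction x using Finsupp.induction_linear with
  | zero => exact zero
  | add f g hf hg => exact add f g hf hg
  | single a r =>
    rw [← mul_one r, ← smul_eq_mul, ← Finsupp.smul_single]
    refine smul r _ ?_
    cases a with
    | X i => rw [single_X]; exact hX _ (by omega)
    | Y j => rw [single_Y]; exact hY _ (by omega)
    | T1 => exact hT _ (by simp)
    | T2 => exact hT _ (by simp)
    | T3 => exact hT _ (by simp)

/-- The bracket is skew-symmetric. -/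
theorem bracket_skew (x y : Carrier K n m) : bracket K n m x y = -bracket K n m y x := by
  induction x using Finsupp.induction_linear with
  | zero => simp
  | add f g hf hg => simp only [map_add, LinearMap.add_apply, hf, hg]; abel
  | single a r =>
    induction y using Finsupp.induction_linear with
    | zero => simp
    | add f g hf hg => simp only [map_add, LinearMap.add_apply, hf, hg]; abel
    | single b t =>
      simp only [bracket, Finsupp.linearCombination_single, LinearMap.smul_apply]
      rw [smul_comm r t, ← smul_neg, ← smul_neg, neg_sub]

theorem bracket_T_T (a b : SLIndex n m) (ha : a = .T1 ∨ a = .T2 ∨ a = .T3)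
    (hb : b = .T1 ∨ b = .T2 ∨ b = .T3) :
    bracket K n m (Finsupp.single a 1) (Finsupp.single b 1) = 0 := by
  rw [bracket_single]
  rcases ha with rfl | rfl | rfl <;> rcases hb with rfl | rfl | rfl <;> simp [table]

/-- Each `T` acts diagonally, with additive weights. -/
theorem exists_weights (a : SLIndex n m) (ha : a = .T1 ∨ a = .T2 ∨ a = .T3) :
    ∃ w v : ℕ → K, (∀ k, bracket K n m (Finsupp.single a 1) (vecX K n m k) = w k • vecX K n m k) ∧
      (∀ k, bracket K n m (Finsupp.single a 1) (vecY K n m k) = v k • vecY K n m k) ∧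
      (∀ k, 2 ≤ k → w (k + 1) = w 1 + w k) ∧ ∀ k, v (k + 1) = w 1 + v k := by
  rcases ha with rfl | rfl | rfl
  · exact ⟨fun k => k, fun k => k, bracket_T1_X, bracket_T1_Y,
      fun k _ => by push_cast; ring, fun k => by push_cast; ring⟩
  · refine ⟨fun k => if 2 ≤ k then 1 else 0, fun k => 0, fun k => ?_, fun k => ?_,
      fun k hk => ?_, fun k => ?_⟩
    · rw [bracket_T2_X]; by_cases h : 2 ≤ k <;> simp [h]
    · rw [bracket_T2_Y]; simp
    · simp [hk, show 2 ≤ k + 1 by omega]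
    · simp
  · refine ⟨fun k => 0, fun k => 1, fun k => ?_, fun k => ?_, fun k hk => ?_, fun k => ?_⟩
    · rw [bracket_T3_X]; simp
    · rw [bracket_T3_Y]; simp
    · simp
    · simp

/-- The sum in the Jacobi identity without signs. -/
noncomputable def jac (x y z : Carrier K n m) : Carrier K n m :=
  bracket K n m x (bracket K n m y z) + bracket K n m y (bracket K n m z x)
    + bracket K n m z (bracket K n m x y)

theorem jac_rot (x y z : Carrier K n m) : jac x y z = jac y z x := by
  simp only [jac]; abel

theorem jac_swap (x y z : Carrier K n m) : jac x y z = -jac y x z := by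
  simp only [jac]
  rw [bracket_skew y z, bracket_skew z x, bracket_skew x y]
  simp only [map_neg]; abel

/-- The vanishing of the Jacobi sum can be checked on basis vectors in the last argument. -/
theorem jac_induction {x y : Carrier K n m} (z : Carrier K n m)
    (hX : ∀ k, 1 ≤ k → jac x y (vecX K n m k) = 0) (hY : ∀ k, 1 ≤ k → jac x y (vecY K n m k) = 0)
    (hT : ∀ a : SLIndex n m, a = .T1 ∨ a = .T2 ∨ a = .T3 → jac x y (Finsupp.single a 1) = 0) :
    jac x y z = 0 := by
  induction z using carrier_induction with
  | zero => simp [jac]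
  | add f g hf hg =>
    rw [← add_zero (0 : Carrier K n m)]; nth_rw 1 [← hf]; rw [← hg]
    simp only [jac, map_add, LinearMap.add_apply]; abel
  | smul r f hf =>
    rw [← smul_zero r, ← hf]
    simp only [jac, map_smul, LinearMap.smul_apply, smul_add]
  | hX c hc => exact hX c hc
  | hY c hc => exact hY c hc
  | hT a ha => exact hT a ha

theorem jac_X_X (a b : ℕ) (z : Carrier K n m) (ha : 1 ≤ a) (hb : 1 ≤ b) :
    jac (vecX K n m a) (vecX K n m b) z = 0 := by
  refine jac_induction z (fun c hc => ?_) (fun c hc => ?_) fun t ht => ?_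
  · simp only [jac, bracket_X_X]
    by_cases h1 : a = 1 <;> by_cases h2 : b = 1 <;> by_cases h3 : c = 1 <;>
      simp [h1, h2, h3, bracket_X_X, show a ≠ 0 by omega, show b ≠ 0 by omega,
        show c ≠ 0 by omega, apply_ite (bracket K n m _)]
  · have h0 : ∀ k, 2 ≤ k → bracket K n m (vecY K n m c) (vecX K n m (k + 1)) = 0 := by
      intro k hk
      rw [bracket_skew, bracket_X_Y _ _ hc, if_neg (by omega), neg_zero]
    simp only [jac, bracket_X_X]
    rw [bracket_skew _ (vecX K n m a)]
    simp only [bracket_X_Y _ _ hc]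
    by_cases h1 : a = 1 <;> by_cases h2 : b = 1 <;>
      simp [h1, h2, bracket_X_Y, apply_ite (bracket K n m _)]
    · exact h0 b
    · exact h0 a
  · obtain ⟨w, v, hw, hv, hw1, hv1⟩ := exists_weights (K := K) t ht
    simp only [jac, bracket_X_X]
    rw [bracket_skew _ (Finsupp.single t 1)]
    simp only [hw]
    by_cases h1 : a = 1 <;> by_cases h2 : b = 1 <;>
      simp [h1, h2, bracket_X_X, hw, apply_ite (bracket K n m _)]
    · by_cases h : 2 ≤ b
      · simp only [h, if_true, hw1 b h]; module
      · simp [h]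
    · by_cases h : 2 ≤ a
      · simp only [h, if_true, hw1 a h]; module
      · simp [h]

theorem jac_Y_Y (a b : ℕ) (z : Carrier K n m) (ha : 1 ≤ a) (hb : 1 ≤ b) :
    jac (vecY K n m a) (vecY K n m b) z = 0 := by
  refine jac_induction z (fun c hc => ?_) (fun c hc => ?_) fun t ht => ?_
  · simp only [jac, bracket_Y_Y]
    rw [bracket_skew _ (vecX K n m c), bracket_X_Y _ _ ha, bracket_X_Y _ _ hb]
    by_cases h : c = 1 ∧ 1 ≤ n <;> simp [h, bracket_Y_Y]
  · simp [jac, bracket_Y_Y]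
  · obtain ⟨w, v, hw, hv, hw1, hv1⟩ := exists_weights (K := K) t ht
    simp only [jac, bracket_Y_Y]
    rw [bracket_skew _ (Finsupp.single t 1)]
    simp [hv, bracket_Y_Y]

theorem jac_T_T (a b : SLIndex n m) (z : Carrier K n m) (ha : a = .T1 ∨ a = .T2 ∨ a = .T3)
    (hb : b = .T1 ∨ b = .T2 ∨ b = .T3) :
    jac (Finsupp.single a 1) (Finsupp.single b 1) z = 0 := by
  obtain ⟨w, v, hw, hv, hw1, hv1⟩ := exists_weights (K := K) a ha
  obtain ⟨w', v', hw', hv', hw1', hv1'⟩ := exists_weights (K := K) b hb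
  refine jac_induction z (fun c hc => ?_) (fun c hc => ?_) fun t ht => ?_
  · simp only [jac, bracket_T_T a b ha hb]
    rw [bracket_skew _ (Finsupp.single a 1)]
    simp only [hw, hw', map_neg, map_smul, map_zero]; module
  · simp only [jac, bracket_T_T a b ha hb]
    rw [bracket_skew _ (Finsupp.single a 1)]
    simp only [hv, hv', map_neg, map_smul, map_zero]; module
  · simp [jac, bracket_T_T _ _ ha hb, bracket_T_T _ _ hb ht, bracket_T_T _ _ ht ha]

theorem jac_X_Y_T (a b : ℕ) (hb : 1 ≤ b) (t : SLIndex n m)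
    (ht : t = .T1 ∨ t = .T2 ∨ t = .T3) :
    jac (vecX K n m a) (vecY K n m b) (Finsupp.single t 1) = 0 := by
  obtain ⟨w, v, hw, hv, hw1, hv1⟩ := exists_weights (K := K) t ht
  simp only [jac]
  rw [bracket_skew (vecY K n m b) (Finsupp.single t 1), bracket_skew (vecY K n m b)]
  simp only [hw, hv, bracket_X_Y _ _ hb, map_neg, map_smul, LinearMap.smul_apply]
  by_cases h : a = 1 ∧ 1 ≤ n
  · simp only [h, and_self, if_true, hv, hv1]; module
  · simp [h]

theorem jac_X_Y (a b : ℕ) (z : Carrier K n m) (ha : 1 ≤ a) (hb : 1 ≤ b) :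
    jac (vecX K n m a) (vecY K n m b) z = 0 := by
  refine jac_induction z (fun c hc => ?_) (fun c hc => ?_) fun t ht => ?_
  · rw [← jac_rot]; exact jac_X_X _ _ _ hc ha
  · rw [jac_rot]; exact jac_Y_Y _ _ _ hb hc
  · exact jac_X_Y_T _ _ hb _ ht

theorem jac_X_T (a : ℕ) (b : SLIndex n m) (z : Carrier K n m) (ha : 1 ≤ a)
    (hb : b = .T1 ∨ b = .T2 ∨ b = .T3) :
    jac (vecX K n m a) (Finsupp.single b 1) z = 0 := by
  refine jac_induction z (fun c hc => ?_) (fun c hc => ?_) fun t ht => ?_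
  · rw [← jac_rot]; exact jac_X_X _ _ _ hc ha
  · rw [← jac_rot, jac_swap, neg_eq_zero]; exact jac_X_Y _ _ _ ha hc
  · rw [jac_rot]; exact jac_T_T _ _ _ hb ht

theorem jac_Y_T (a : ℕ) (b : SLIndex n m) (z : Carrier K n m) (ha : 1 ≤ a)
    (hb : b = .T1 ∨ b = .T2 ∨ b = .T3) :
    jac (vecY K n m a) (Finsupp.single b 1) z = 0 := by
  refine jac_induction z (fun c hc => ?_) (fun c hc => ?_) fun t ht => ?_
  · rw [← jac_rot]; exact jac_X_Y _ _ _ hc ha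
  · rw [← jac_rot]; exact jac_Y_Y _ _ _ hc ha
  · rw [jac_rot]; exact jac_T_T _ _ _ hb ht

/-- The Jacobi identity without signs. -/
theorem jac_eq_zero (x y z : Carrier K n m) : jac x y z = 0 := by
  rw [jac_rot]
  refine jac_induction x (fun a ha => ?_) (fun a ha => ?_) fun a ha => ?_
  all_goals
    rw [jac_rot]
    refine jac_induction y (fun b hb => ?_) (fun b hb => ?_) fun b hb => ?_
    all_goals rw [jac_rot]
  · exact jac_X_X _ _ _ ha hb
  · exact jac_X_Y _ _ _ ha hb
  · exact jac_X_T _ _ _ ha hb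
  · rw [jac_swap, neg_eq_zero]; exact jac_X_Y _ _ _ hb ha
  · exact jac_Y_Y _ _ _ ha hb
  · exact jac_Y_T _ _ _ ha hb
  · rw [jac_swap, neg_eq_zero]; exact jac_X_T _ _ _ hb ha
  · rw [jac_swap, neg_eq_zero]; exact jac_Y_T _ _ _ hb ha
  · exact jac_T_T _ _ _ ha hb

theorem table_odd_odd (a b : SLIndex n m) (ha : parity a = 1) (hb : parity b = 1) :
    table K n m a b = 0 := by
  cases a <;> cases b <;> simp_all [parity, table]

theorem vecX_mem (k : ℕ) : vecX K n m k ∈ part K n m 0 := by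
  simp only [vecX]
  split_ifs
  · exact Finsupp.single_mem_supported K 1 rfl
  · exact zero_mem _

theorem vecY_mem (k : ℕ) : vecY K n m k ∈ part K n m 1 := by
  simp only [vecY]
  split_ifs
  · exact Finsupp.single_mem_supported K 1 rfl
  · exact zero_mem _

theorem table_mem (a b : SLIndex n m) : table K n m a b ∈ part K n m (parity a + parity b) := by
  have hite : ∀ (c : Prop) [Decidable c] (v : Carrier K n m) (α : ZMod 2), v ∈ part K n m α →
      (if c then v else 0) ∈ part K n m α := by
    intro c _ v α hv
    by_cases h : c
    · rwa [if_pos h]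
    · rw [if_neg h]; exact zero_mem _
  cases a <;> cases b <;> simp only [table, parity, add_zero, zero_add]
  case X.X => exact hite _ _ _ (vecX_mem _)
  case X.Y => exact hite _ _ _ (vecY_mem _)
  case T1.X => exact Submodule.smul_mem _ _ (vecX_mem _)
  case T1.Y => exact Submodule.smul_mem _ _ (vecY_mem _)
  case T2.X => exact hite _ _ _ (vecX_mem _)
  case T3.Y => exact vecY_mem _
  all_goals exact zero_mem _

theorem part_induction {p : Carrier K n m → Prop} {α : ZMod 2} {x : Carrier K n m}
    (hx : x ∈ part K n m α) (zero : p 0) (add : ∀ x y, p x → p y → p (x + y))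
    (smul : ∀ (r : K) x, p x → p (r • x))
    (basis : ∀ a : SLIndex n m, parity a = α → p (Finsupp.single a 1)) : p x := by
  rw [part, Finsupp.supported_eq_span_single] at hx
  induction hx using Submodule.span_induction with
  | mem x h => obtain ⟨a, ha, rfl⟩ := h; exact basis a ha
  | zero => exact zero
  | add x y _ _ h h' => exact add x y h h'
  | smul r x _ h => exact smul r x h

theorem bracket_mem_part {α β : ZMod 2} {x y : Carrier K n m} (hx : x ∈ part K n m α)
    (hy : y ∈ part K n m β) : bracket K n m x y ∈ part K n m (α + β) := by
  refine part_induction (p := fun x => bracket K n m x y ∈ part K n m (α + β)) hx (by simp)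
    (fun f g hf hg => by simpa using add_mem hf hg)
    (fun r f hf => by simpa using Submodule.smul_mem _ r hf) fun a ha => ?_
  refine part_induction (p := fun y => bracket K n m _ y ∈ part K n m (α + β)) hy (by simp)
    (fun f g hf hg => by simpa using add_mem hf hg)
    (fun r f hf => by simpa using Submodule.smul_mem _ r hf) fun b hb => ?_
  rw [bracket_single, ← ha, ← hb]
  refine sub_mem (table_mem a b) ?_
  rw [add_comm]
  exact table_mem b a

theorem bracket_odd_odd {x y : Carrier K n m} (hx : x ∈ part K n m 1)
    (hy : y ∈ part K n m 1) : bracket K n m x y = 0 := by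
  refine part_induction (p := fun x => bracket K n m x y = 0) hx (by simp)
    (fun f g hf hg => by simp [hf, hg]) (fun r f hf => by simp [hf]) fun a ha => ?_
  refine part_induction (p := fun y => bracket K n m _ y = 0) hy (by simp)
    (fun f g hf hg => by simp [hf, hg]) (fun r f hf => by simp [hf]) fun b hb => ?_
  rw [bracket_single, table_odd_odd a b ha hb, table_odd_odd b a hb ha, sub_zero]

end facts


/-- The Lie superalgebra `SL^{n,m}`. -/
noncomputable def superalgebra : LieSuperalgebra K (Carrier K n m) where
  part := part K n m
  isCompl := by
    have hd : Disjoint {a : SLIndex n m | parity a = 0} {a | parity a = 1} :=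
      Set.disjoint_left.2 fun a h h' => by
        rw [Set.mem_ofPred_eq] at h h'
        rw [h] at h'
        exact absurd h' (by decide)
    have hc : {a : SLIndex n m | parity a = 0} ∪ {a | parity a = 1} = Set.univ :=
      Set.eq_univ_of_forall fun a => by cases a <;> simp [parity]
    refine ⟨Finsupp.disjoint_supported_supported hd, codisjoint_iff.2 ?_⟩
    rw [part, part, ← Finsupp.supported_union, hc, Finsupp.supported_univ]
  bracket := bracket K n m
  bracket_mem _ _ _ _ hx hy := bracket_mem_part hx hy
  skew α β x y hx hy := by
    rw [bracket_skew]
    by_cases h : α = 1 ∧ β = 1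
    · obtain ⟨rfl, rfl⟩ := h
      simp [bracket_odd_odd hy hx]
    · have : α.val * β.val = 0 := by
        have : ∀ α β : ZMod 2, ¬(α = 1 ∧ β = 1) → α.val * β.val = 0 := by decide
        exact this α β h
      simp [this]
  jacobi α β γ x y z hx hy hz := by
    have hJ := jac_eq_zero x y z
    rw [jac] at hJ
    have h2 : ∀ α : ZMod 2, α = 0 ∨ α = 1 := by decide
    have key : ∀ {ε ζ : ZMod 2} {u v w : Carrier K n m}, u ∈ part K n m 1 → v ∈ part K n m ε →
        w ∈ part K n m ζ → ε + ζ = 1 → bracket K n m u (bracket K n m v w) = 0 :=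
      fun hu hv hw h => bracket_odd_odd hu (h ▸ bracket_mem_part hv hw)
    have h01 : (0 : ZMod 2) + 1 = 1 := by decide
    have h10 : (1 : ZMod 2) + 0 = 1 := by decide
    rcases h2 α with rfl | rfl <;> rcases h2 β with rfl | rfl <;> rcases h2 γ with rfl | rfl
    · simpa using hJ
    · simpa using hJ
    · simpa using hJ
    · rw [bracket_odd_odd hy hz, key hy hz hx h10, key hz hx hy h01]; simp
    · simpa using hJ
    · rw [bracket_odd_odd hz hx, key hx hy hz h01, key hz hx hy h10]; simp
    · rw [bracket_odd_odd hx hy, key hx hy hz h10, key hy hz hx h01]; simp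
    · rw [bracket_odd_odd hx hy, bracket_odd_odd hy hz, bracket_odd_odd hz hx]; simp

end SL

/-! The torus spanned by T₁, T₂, T₃ acts diagonally, and this leaves almost no room for cocycles.
Take the regular element R = T₁ + N T₂ + N² T₃ with N large. Its eigenvalues are 0 on the torus, 1
on X₁, k + N on X_k for k ≥ 2, and j + N² on Y_j. These are pairwise distinct outside the torus, so
every nonzero weight space is at most a line.

A cocycle can be corrected by a coboundary until its contraction with R preserves weights. The
cocycle identity with R as an argument then forces the whole cocycle to add weights
(`exists_preservesWeights`). This is the usual fact that a diagonalizable inner derivation acts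
trivially on cohomology, so that only weight zero contributes.

A weight-adding cocycle satisfies c(X₁, X_k) = a_k X_{k+1} and c(X₁, Y_k) = b_k Y_{k+1}. Both
families are removed by a diagonal 1-cochain whose eigenvalues are partial sums of the a_k and b_k.
On the torus the same 1-cochain is chosen to remove c(t, X₁), c(t, X₂), c(t, Y₁), which is possible
because the weights of X₁, X₂, Y₁ form a basis of the dual of the torus (`exists_isNormalized`).

Nothing is left after that (`eq_zero_of_isNormalized`). Vanishing of c(t, ·) propagates from the
generators along ad X₁. The value c(t, t') is a torus element commuting with X₁, X₂, Y₁, hence zero.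
The remaining values c(X_k, X_l) with k, l ≥ 2, c(X_k, Y_l) with k ≥ 2, and c(Y_k, Y_l) have weights
that do not occur. Thus Z² = B², and the graded statement follows since d respects parity. -/

namespace LieSuperalgebra

variable {K V : Type*} [Field K] [AddCommGroup V] [Module K V] (L : LieSuperalgebra K V)

/-! ### Reduction of all the cohomology spaces to the inclusion Z² ≤ B² -/

/-- Every 1-cochain is a sum of a cochain of parity `p` and one of parity `p + 1`. -/
theorem exists_parity_decomposition (p : ZMod 2) (f : L.Cochain1) :
    ∃ a ∈ L.C1p p, ∃ b ∈ L.C1p (p + 1), f = a + b := by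
  have h2 : ∀ p : ZMod 2, p = 0 ∨ p = 1 := by decide
  have hc : ∀ p : ZMod 2, IsCompl (L.part p) (L.part (p + 1)) := by
    intro p
    rcases h2 p with rfl | rfl
    · exact L.isCompl
    · exact L.isCompl.symm
  have key : ∀ (p : ZMod 2), ∃ P Q : V →ₗ[K] V, (∀ v, P v ∈ L.part p) ∧
      (∀ v, Q v ∈ L.part (p + 1)) ∧ ∀ v, v = P v + Q v := by
    intro p
    exact ⟨Submodule.projection _ _ (hc p), LinearMap.id - Submodule.projection _ _ (hc p),
      fun v => Submodule.projection_apply_mem (hc p) v,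
      fun v => Submodule.sub_projection_mem (hc p) v, fun v => by simp⟩
  obtain ⟨P, Q, hP, hQ, hs⟩ := key p
  obtain ⟨P', Q', hP', hQ', hs'⟩ := key (p + 1)
  refine ⟨(P ∘ₗ f.1, P' ∘ₗ f.2), ⟨fun g => hP _, fun h => hP' _⟩, (Q ∘ₗ f.1, Q' ∘ₗ f.2),
    ⟨fun g => hQ _, fun h => hQ' _⟩, ?_⟩
  refine Prod.ext (LinearMap.ext fun g => hs _) (LinearMap.ext fun h => hs' _)

/-- A coboundary of parity `p` is the coboundary of a cochain of parity `p`. -/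
theorem mem_B2p_of_mem_B2 (h2 : (2 : K) ≠ 0) (p : ZMod 2) {c : L.PreCochain2}
    (hc : c ∈ L.C2p p) (hB : c ∈ L.B2) : c ∈ L.B2p p := by
  obtain ⟨f, rfl⟩ := hB
  obtain ⟨a, ha, b, hb, rfl⟩ := L.exists_parity_decomposition p f
  -- The differential respects parity, so `d1 b` has parity p + 1. As the difference of two cochains
  -- of parity p it also has parity p. Hence it vanishes, and `a` alone is a primitive.
  have h1 : L.d1 b ∈ L.C2p (p + 1) := (L.B2p_le_Z2p h2 (p + 1) ⟨b, hb, rfl⟩).1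
  have h3 : L.d1 b ∈ L.C2p p := by
    have h4 := sub_mem hc (L.B2p_le_Z2p h2 p ⟨a, ha, rfl⟩).1
    rwa [map_add, add_sub_cancel_left] at h4
  have hd : ∀ (q : ZMod 2) (v : V), v ∈ L.part q → v ∈ L.part (q + 1) → v = 0 := by
    intro q v h h'
    have : ∀ p : ZMod 2, p = 0 ∨ p = 1 := by decide
    rcases this q with rfl | rfl
    · exact Submodule.disjoint_def.1 L.isCompl.disjoint v h h'
    · exact Submodule.disjoint_def.1 L.isCompl.disjoint v h' h
  have h0 : L.d1 b = 0 := by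
    refine Prod.ext ?_ (Prod.ext ?_ ?_) <;> refine LinearMap.ext₂ fun x y => ?_
    · exact hd _ _ (h3.2.1 x y) (h1.2.1 x y)
    · exact hd _ _ (h3.2.2.1 x y) (h1.2.2.1 x y)
    · exact hd _ _ (h3.2.2.2 x y) (h1.2.2.2 x y)
  exact ⟨a, ha, by rw [map_add, h0, add_zero]⟩

/-- If every cocycle is a coboundary then all the second cohomology spaces vanish. -/
theorem rank_H2_eq_zero (h2 : (2 : K) ≠ 0) (h : L.Z2 ≤ L.B2) :
    Module.rank K L.H2 = 0 ∧ ∀ p, Module.rank K (L.H2p p) = 0 := by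
  have key : ∀ Z B : Submodule K L.PreCochain2, Z ≤ B → Module.rank K (SubQuot Z B) = 0 := by
    intro Z B hZB
    have : Subsingleton (SubQuot Z B) :=
      Submodule.Quotient.subsingleton_iff.2 (Submodule.comap_subtype_eq_top.2 hZB)
    exact rank_subsingleton' K _
  exact ⟨key _ _ h, fun p => key _ _ fun c hc =>
    L.mem_B2p_of_mem_B2 h2 p hc.1 (h ⟨hc.1.1, hc.2⟩)⟩

end LieSuperalgebra

/-! ### Cocycle identities in components -/

namespace LieSuperalgebra

variable {K V : Type*} [Field K] [AddCommGroup V] [Module K V] (L : LieSuperalgebra K V)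

theorem d2_even_even_even {c : L.PreCochain2} (hc : c ∈ L.Z2) (g₁ g₂ g₃ : L.Even) :
    c.1 (L.br00 g₁ g₂) g₃ - c.1 (L.br00 g₁ g₃) g₂ + c.1 (L.br00 g₂ g₃) g₁
        - L.bracket g₁ (c.1 g₂ g₃) + L.bracket g₂ (c.1 g₁ g₃) - L.bracket g₃ (c.1 g₁ g₂) = 0 :=
  congrFun (congrFun (congrFun (congrArg (fun d => d.1) (LinearMap.mem_ker.1 hc.2)) g₁) g₂) g₃

theorem d2_even_even_odd {c : L.PreCochain2} (hc : c ∈ L.Z2) (g₁ g₂ : L.Even) (h : L.Odd) :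
    c.2.1 (L.br00 g₁ g₂) h + c.2.1 g₂ (L.br01 g₁ h) - c.2.1 g₁ (L.br01 g₂ h)
        - L.bracket g₁ (c.2.1 g₂ h) + L.bracket g₂ (c.2.1 g₁ h) - L.bracket h (c.1 g₁ g₂) = 0 :=
  congrFun (congrFun (congrFun (congrArg (fun d => d.2.1) (LinearMap.mem_ker.1 hc.2)) g₁) g₂) h

theorem d2_even_odd_odd {c : L.PreCochain2} (hc : c ∈ L.Z2) (g : L.Even) (h₁ h₂ : L.Odd) :
    c.2.2 (L.br01 g h₁) h₂ + c.2.2 (L.br01 g h₂) h₁ + c.1 (L.br11 h₁ h₂) g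
        - L.bracket g (c.2.2 h₁ h₂) + L.bracket h₁ (c.2.1 g h₂) + L.bracket h₂ (c.2.1 g h₁) = 0 :=
  congrFun (congrFun (congrFun (congrArg (fun d => d.2.2.1) (LinearMap.mem_ker.1 hc.2)) g) h₁) h₂

theorem C2_swap {c : L.PreCochain2} (hc : c ∈ L.C2) (g g' : L.Even) : c.1 g g' = -c.1 g' g := by
  have h := hc.1 (g + g')
  simp only [map_add, LinearMap.add_apply, hc.1, zero_add, add_zero] at h
  rw [add_comm] at h
  exact eq_neg_of_add_eq_zero_left h

/-- Subtracting a coboundary from a cocycle, in components. -/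
theorem exists_sub_d1 (h2 : (2 : K) ≠ 0) {c : L.PreCochain2} (hc : c ∈ L.Z2) (f : L.Cochain1) :
    ∃ c' ∈ L.Z2, (∀ g g', c'.1 g g' = c.1 g g'
        - (f.1 (L.br00 g g') - L.bracket g (f.1 g') + L.bracket g' (f.1 g))) ∧
      (∀ g h, c'.2.1 g h = c.2.1 g h
        - (f.2 (L.br01 g h) - L.bracket g (f.2 h) + L.bracket h (f.1 g))) ∧
      (c' ∈ L.B2 → c ∈ L.B2) := by
  refine ⟨c - L.d1 f, sub_mem hc (L.B2_le_Z2 h2 ⟨f, rfl⟩), fun g g' => rfl, fun g h => rfl,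
    fun h => ?_⟩
  have : c = c - L.d1 f + L.d1 f := (sub_add_cancel _ _).symm
  rw [this]
  exact add_mem h ⟨f, rfl⟩

end LieSuperalgebra

/-! ### Weights of a regular torus element -/

namespace SL

open LieSuperalgebra

variable {K : Type*} [Field K] {n m : ℕ}

/-- The diagonal operator with the given eigenvalues on the basis. -/
noncomputable def diag (d : SLIndex n m → K) : Carrier K n m →ₗ[K] Carrier K n m :=
  Finsupp.linearCombination K fun a => Finsupp.single a (d a)

theorem diag_apply (d : SLIndex n m → K) (v : Carrier K n m) (k : SLIndex n m) :
    diag d v k = d k * v k := by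
  classical
  induction v using Finsupp.induction_linear with
  | zero => simp
  | add f g hf hg => simp only [map_add, Finsupp.add_apply, hf, hg, mul_add]
  | single a r =>
    simp only [diag, Finsupp.linearCombination_single, Finsupp.smul_apply, smul_eq_mul,
      Finsupp.single_apply]
    by_cases h : a = k
    · subst h; simp [mul_comm]
    · simp [h]

/-- A step larger than all the differences of `T₁`-weights. -/
def step (n m : ℕ) : ℕ := n + m + 6

/-- The eigenvalues of `T₁ + N T₂ + N² T₃` on the basis, where `N = step n m`. -/
def weight : SLIndex n m → ℕ
  | .X i => if i.val = 0 then 1 else i.val + 1 + step n m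
  | .Y j => j.val + 1 + step n m ^ 2
  | _ => 0

/-- The span of the basis vectors of weight `k`. -/
noncomputable def weightSpace (K : Type*) [Field K] (n m k : ℕ) : Submodule K (Carrier K n m) :=
  Finsupp.supported K K {a | weight a = k}

theorem mem_weightSpace {k : ℕ} {v : Carrier K n m} :
    v ∈ weightSpace K n m k ↔ ∀ a, weight a ≠ k → v a = 0 := by
  rw [weightSpace, Finsupp.mem_supported]
  constructor
  · intro h a ha
    by_contra hv
    exact ha (h (Finsupp.mem_support_iff.2 hv))
  · intro h a ha
    by_contra hv
    exact Finsupp.mem_support_iff.1 ha (h a hv)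

theorem weightSpace_induction {p : Carrier K n m → Prop} {k : ℕ} {x : Carrier K n m}
    (hx : x ∈ weightSpace K n m k) (zero : p 0) (add : ∀ x y, p x → p y → p (x + y))
    (smul : ∀ (r : K) x, p x → p (r • x))
    (basis : ∀ a : SLIndex n m, weight a = k → p (Finsupp.single a 1)) : p x := by
  rw [weightSpace, Finsupp.supported_eq_span_single] at hx
  induction hx using Submodule.span_induction with
  | mem x h => obtain ⟨a, ha, rfl⟩ := h; exact basis a ha
  | zero => exact zero
  | add x y _ _ h h' => exact add x y h h'
  | smul r x _ h => exact smul r x h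

/-- The element `p T₁ + q T₂ + r T₃`. -/
noncomputable def torus (p q r : K) : (superalgebra K n m).Even :=
  ⟨p • Finsupp.single .T1 1 + q • Finsupp.single .T2 1 + r • Finsupp.single .T3 1,
    add_mem (add_mem (Submodule.smul_mem _ _ (Finsupp.single_mem_supported K 1 rfl))
      (Submodule.smul_mem _ _ (Finsupp.single_mem_supported K 1 rfl)))
      (Submodule.smul_mem _ _ (Finsupp.single_mem_supported K 1 rfl))⟩

theorem bracket_torus_X (p q r : K) (k : ℕ) :
    bracket K n m (torus (n := n) (m := m) p q r : Carrier K n m) (vecX K n m k)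
      = (p * k + if 2 ≤ k then q else 0) • vecX K n m k := by
  simp only [torus, map_add, map_smul, LinearMap.add_apply, LinearMap.smul_apply, bracket_T1_X,
    bracket_T2_X, bracket_T3_X]
  split_ifs <;> module

theorem bracket_torus_Y (p q r : K) (k : ℕ) :
    bracket K n m (torus (n := n) (m := m) p q r : Carrier K n m) (vecY K n m k)
      = (p * k + r) • vecY K n m k := by
  simp only [torus, map_add, map_smul, LinearMap.add_apply, LinearMap.smul_apply, bracket_T1_Y,
    bracket_T2_Y, bracket_T3_Y]
  module

theorem bracket_torus_T (p q r : K) (a : SLIndex n m) (ha : a = .T1 ∨ a = .T2 ∨ a = .T3) :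
    bracket K n m (torus (n := n) (m := m) p q r : Carrier K n m) (Finsupp.single a 1) = 0 := by
  simp only [torus, map_add, map_smul, LinearMap.add_apply, LinearMap.smul_apply,
    bracket_T_T _ a (Or.inl rfl) ha, bracket_T_T _ a (Or.inr (Or.inl rfl)) ha,
    bracket_T_T _ a (Or.inr (Or.inr rfl)) ha]
  simp

/-- A regular element of the torus, with eigenvalues `weight`. -/
noncomputable def regular (K : Type*) [Field K] (n m : ℕ) : (superalgebra K n m).Even :=
  torus 1 (step n m : K) ((step n m : K) ^ 2)

theorem bracket_regular (v : Carrier K n m) :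
    bracket K n m (regular K n m : Carrier K n m) v = diag (fun a => (weight a : K)) v := by
  induction v using Finsupp.induction_linear with
  | zero => simp
  | add f g hf hg => simp only [map_add, hf, hg]
  | single a r =>
    rw [← mul_one r, ← smul_eq_mul, ← Finsupp.smul_single, map_smul, map_smul]
    congr 1
    have hd : diag (fun a => (weight a : K)) (Finsupp.single a 1)
        = (weight a : K) • Finsupp.single a 1 := by simp [diag]
    rw [hd]
    cases a with
    | X i =>
      rw [single_X, regular, bracket_torus_X]
      by_cases h : i.val = 0
      · simp [weight, h]
      · simp [weight, h, Nat.one_le_iff_ne_zero]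
    | Y j => rw [single_Y, regular, bracket_torus_Y]; simp [weight]
    | T1 => rw [regular, bracket_torus_T _ _ _ _ (by simp)]; simp [weight]
    | T2 => rw [regular, bracket_torus_T _ _ _ _ (by simp)]; simp [weight]
    | T3 => rw [regular, bracket_torus_T _ _ _ _ (by simp)]; simp [weight]

theorem bracket_regular_of_mem {k : ℕ} {v : Carrier K n m} (hv : v ∈ weightSpace K n m k) :
    bracket K n m (regular K n m : Carrier K n m) v = (k : K) • v := by
  rw [bracket_regular]
  ext a
  rw [diag_apply, Finsupp.smul_apply, smul_eq_mul]
  by_cases h : weight a = k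
  · rw [h]
  · rw [mem_weightSpace.1 hv a h]; simp

/-- The operator ad R − k is diagonal with entries `weight a - k`, which are invertible off the
weight space because distinct naturals stay distinct in characteristic 0. The hypothesis is weaker
than an eigenvector equation, and it is what the cocycle identity supplies in
`preservesWeights_of_regular`. -/
theorem mem_weightSpace_of_sub_mem [CharZero K] {k : ℕ} {v : Carrier K n m}
    (hv : bracket K n m (regular K n m : Carrier K n m) v - (k : K) • v ∈ weightSpace K n m k) :
    v ∈ weightSpace K n m k := by
  rw [mem_weightSpace] at hv ⊢
  intro a ha
  have h := hv a ha
  rw [bracket_regular, Finsupp.sub_apply, diag_apply, Finsupp.smul_apply, smul_eq_mul,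
    ← sub_mul] at h
  exact (mul_eq_zero.1 h).resolve_left (sub_ne_zero.2 (Nat.cast_injective.ne ha))

theorem mem_weightSpace_of_bracket_eq [CharZero K] {k : ℕ} {v : Carrier K n m}
    (hv : bracket K n m (regular K n m : Carrier K n m) v = (k : K) • v) :
    v ∈ weightSpace K n m k :=
  mem_weightSpace_of_sub_mem (by rw [hv, sub_self]; exact zero_mem _)

/-- By the Jacobi identity ad R is a derivation, so its eigenvalues add under the bracket. -/
theorem bracket_mem_weightSpace [CharZero K] {k l : ℕ} {x y : Carrier K n m}
    (hx : x ∈ weightSpace K n m k) (hy : y ∈ weightSpace K n m l) :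
    bracket K n m x y ∈ weightSpace K n m (k + l) := by
  refine mem_weightSpace_of_bracket_eq ?_
  have h := jac_eq_zero (regular K n m : Carrier K n m) x y
  rw [jac, bracket_skew y (regular K n m), bracket_regular_of_mem hx, bracket_regular_of_mem hy,
    bracket_skew y] at h
  simp only [map_neg, map_smul, LinearMap.smul_apply] at h
  rw [← sub_eq_zero, ← h]
  push_cast
  module

theorem vecX_one_mem_weightSpace : vecX K n m 1 ∈ weightSpace K n m 1 := by
  rw [vecX]
  split_ifs
  · exact Finsupp.single_mem_supported K 1 (by simp [weight])
  · exact zero_mem _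

theorem vecX_mem_weightSpace {k : ℕ} (hk : 2 ≤ k) :
    vecX K n m k ∈ weightSpace K n m (k + step n m) := by
  rw [vecX]
  split_ifs
  · refine Finsupp.single_mem_supported K 1 ?_
    simp [weight, show k - 1 ≠ 0 by omega]; omega
  · exact zero_mem _

theorem vecY_mem_weightSpace (k : ℕ) :
    vecY K n m k ∈ weightSpace K n m (k + step n m ^ 2) := by
  rw [vecY]
  split_ifs
  · refine Finsupp.single_mem_supported K 1 ?_
    simp [weight]; omega
  · exact zero_mem _

theorem torus_mem_weightSpace (p q r : K) :
    (torus (n := n) (m := m) p q r : Carrier K n m) ∈ weightSpace K n m 0 :=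
  add_mem (add_mem (Submodule.smul_mem _ _ (Finsupp.single_mem_supported K 1 rfl))
      (Submodule.smul_mem _ _ (Finsupp.single_mem_supported K 1 rfl)))
      (Submodule.smul_mem _ _ (Finsupp.single_mem_supported K 1 rfl))

/-! ### The individual weight spaces -/

theorem exists_eq_smul_of_mem {k : ℕ} {v : Carrier K n m} (hv : v ∈ weightSpace K n m k)
    (u : Carrier K n m)
    (hu : ∀ a : SLIndex n m, weight a = k → Finsupp.single a 1 = u) : ∃ r : K, v = r • u := by
  refine weightSpace_induction (p := fun v => ∃ r : K, v = r • u) hv ⟨0, by simp⟩ ?_ ?_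
    fun a ha => ⟨1, by rw [hu a ha, one_smul]⟩
  · rintro _ _ ⟨r, rfl⟩ ⟨s, rfl⟩; exact ⟨r + s, by rw [add_smul]⟩
  · rintro s _ ⟨r, rfl⟩; exact ⟨s * r, by rw [mul_smul]⟩

/-- The left side is 4N for N = `step n m`, so this is just N ≥ 4. It places the sum of the weights
of any two X's no higher than N², below every weight of a Y. -/
theorem step_sq : 3 * step n m + n + m + 6 ≤ step n m ^ 2 := by
  simp only [step]; nlinarith

theorem exists_eq_smul_vecX_one {v : Carrier K n m} (hv : v ∈ weightSpace K n m 1) :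
    ∃ r : K, v = r • vecX K n m 1 := by
  refine exists_eq_smul_of_mem hv _ fun a ha => ?_
  have hs := step_sq (n := n) (m := m)
  have hs' : step n m = n + m + 6 := rfl
  cases a with
  | X i =>
    by_cases h : i.val = 0
    · rw [single_X, h]
    · simp only [weight, h, if_false] at ha; omega
  | _ => simp only [weight] at ha; omega

/-- The case k = n + 1 is included because c(X₁, X_n) has that weight; there both the weight space
and `vecX` are zero. Some upper bound is needed, since for large k the weight may be that of a Y. -/
theorem exists_eq_smul_vecX {k : ℕ} {v : Carrier K n m} (hk : 2 ≤ k) (hk' : k ≤ n + 1)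
    (hv : v ∈ weightSpace K n m (k + step n m)) : ∃ r : K, v = r • vecX K n m k := by
  refine exists_eq_smul_of_mem hv _ fun a ha => ?_
  have hs := step_sq (n := n) (m := m)
  have hs' : step n m = n + m + 6 := rfl
  cases a with
  | X i =>
    by_cases h : i.val = 0
    · simp only [weight, h, if_true] at ha; omega
    · simp only [weight, h, if_false] at ha
      rw [single_X, show i.val + 1 = k by omega]
  | _ => simp only [weight] at ha; omega

theorem exists_eq_smul_vecY {k : ℕ} {v : Carrier K n m}
    (hv : v ∈ weightSpace K n m (k + step n m ^ 2)) : ∃ r : K, v = r • vecY K n m k := by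
  refine exists_eq_smul_of_mem hv _ fun a ha => ?_
  have hs := step_sq (n := n) (m := m)
  have hs' : step n m = n + m + 6 := rfl
  cases a with
  | X i =>
    have := i.2
    by_cases h : i.val = 0 <;> simp only [weight, h, if_true, if_false] at ha <;> omega
  | Y j =>
    simp only [weight] at ha
    rw [single_Y, show j.val + 1 = k by omega]
  | _ => simp only [weight] at ha; omega

theorem exists_eq_torus {v : Carrier K n m} (hv : v ∈ weightSpace K n m 0) :
    ∃ p q r : K, v = (torus (n := n) (m := m) p q r : Carrier K n m) := by
  refine weightSpace_induction
    (p := fun v => ∃ p q r : K, v = (torus (n := n) (m := m) p q r : Carrier K n m)) hv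
    ⟨0, 0, 0, by simp [torus]⟩ ?_ ?_ fun a ha => ?_
  · rintro _ _ ⟨p, q, r, rfl⟩ ⟨p', q', r', rfl⟩
    exact ⟨p + p', q + q', r + r', by simp only [torus]; module⟩
  · rintro s _ ⟨p, q, r, rfl⟩
    exact ⟨s * p, s * q, s * r, by simp only [torus]; module⟩
  · cases a with
    | X i => by_cases h : i.val = 0 <;> simp [weight, h] at ha
    | Y j => simp [weight] at ha
    | T1 => exact ⟨1, 0, 0, by simp [torus]⟩
    | T2 => exact ⟨0, 1, 0, by simp [torus]⟩
    | T3 => exact ⟨0, 0, 1, by simp [torus]⟩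

/-- The two alternatives describe the gap between the X's and the Y's and the range above all Y's.
The value N² itself is free, because the weights of the Y's start at N² + 1. -/
theorem eq_zero_of_mem_weightSpace {k : ℕ} {v : Carrier K n m} (hv : v ∈ weightSpace K n m k)
    (hk : n + step n m < k) (hk' : k ≤ step n m ^ 2 ∨ m + step n m ^ 2 < k) : v = 0 := by
  obtain ⟨r, hr⟩ := exists_eq_smul_of_mem hv 0 fun a ha => by
    cases a with
    | X i =>
      have := i.2
      by_cases h : i.val = 0 <;> simp only [weight, h, if_true, if_false] at ha <;> omega
    | Y j => have := j.2; simp only [weight] at ha; omega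
    | _ => simp only [weight] at ha; omega
  simpa using hr

/-! ### Reduction to cocycles that add weights -/

theorem superalgebra_bracket : (superalgebra K n m).bracket = bracket K n m := rfl

/-- The cochain adds the weights of its arguments. -/
structure PreservesWeights (c : (superalgebra K n m).PreCochain2) : Prop where
  even_even : ∀ (k l : ℕ) (g g' : (superalgebra K n m).Even), (g : Carrier K n m) ∈ weightSpace K n m k →
    (g' : Carrier K n m) ∈ weightSpace K n m l → c.1 g g' ∈ weightSpace K n m (k + l)
  even_odd : ∀ (k l : ℕ) (g : (superalgebra K n m).Even) (h : (superalgebra K n m).Odd),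
    (g : Carrier K n m) ∈ weightSpace K n m k →
    (h : Carrier K n m) ∈ weightSpace K n m l → c.2.1 g h ∈ weightSpace K n m (k + l)
  odd_odd : ∀ (k l : ℕ) (h h' : (superalgebra K n m).Odd), (h : Carrier K n m) ∈ weightSpace K n m k →
    (h' : Carrier K n m) ∈ weightSpace K n m l → c.2.2 h h' ∈ weightSpace K n m (k + l)

theorem br00_regular {k : ℕ} {g : (superalgebra K n m).Even}
    (hg : (g : Carrier K n m) ∈ weightSpace K n m k) :
    (superalgebra K n m).br00 (regular K n m) g = (k : K) • g :=
  Subtype.ext (bracket_regular_of_mem hg)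

theorem br01_regular {k : ℕ} {h : (superalgebra K n m).Odd}
    (hh : (h : Carrier K n m) ∈ weightSpace K n m k) :
    (superalgebra K n m).br01 (regular K n m) h = (k : K) • h :=
  Subtype.ext (bracket_regular_of_mem hh)

theorem br11_eq_zero (h h' : (superalgebra K n m).Odd) : (superalgebra K n m).br11 h h' = 0 :=
  Subtype.ext (bracket_odd_odd h.2 h'.2)

/-- A cocycle adds weights as soon as its contraction with a regular element preserves them. -/
theorem preservesWeights_of_regular [CharZero K] {c : (superalgebra K n m).PreCochain2}
    (hc : c ∈ (superalgebra K n m).Z2)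
    (h0 : ∀ (k : ℕ) (g : (superalgebra K n m).Even), (g : Carrier K n m) ∈ weightSpace K n m k →
      c.1 (regular K n m) g ∈ weightSpace K n m k)
    (h1 : ∀ (k : ℕ) (h : (superalgebra K n m).Odd), (h : Carrier K n m) ∈ weightSpace K n m k →
      c.2.1 (regular K n m) h ∈ weightSpace K n m k) : PreservesWeights c := by
  refine ⟨fun k l g g' hg hg' => ?_, fun k l g h hg hh => ?_, fun k l h h' hh hh' => ?_⟩ <;>
    refine mem_weightSpace_of_sub_mem ?_
  -- With R in the first slot the cocycle identity reads [R, c(g,g')] − (k+l) c(g,g') = [g, c(R,g')]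
  -- − [g', c(R,g)] − c(R, [g,g']), and every term on the right has weight k + l. The other two
  -- cases use the same pattern.
  · have e := d2_even_even_even _ hc (regular K n m) g g'
    rw [br00_regular hg, br00_regular hg', C2_swap _ hc.1 _ (regular K n m), superalgebra_bracket,
      map_smul, map_smul, LinearMap.smul_apply, LinearMap.smul_apply, C2_swap _ hc.1 g' g] at e
    have m1 := h0 (k + l) ((superalgebra K n m).br00 g g') (bracket_mem_weightSpace hg hg')
    have m2 := bracket_mem_weightSpace hg (h0 l g' hg')
    have m3 := bracket_mem_weightSpace hg' (h0 k g hg)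
    rw [add_comm l k] at m3
    have m4 := sub_mem (sub_mem m2 m3) m1
    convert m4 using 1
    rw [← sub_eq_zero, ← neg_eq_zero, ← e]
    push_cast
    module
  · have e := d2_even_even_odd _ hc (regular K n m) g h
    rw [br00_regular hg, br01_regular hh, superalgebra_bracket,
      map_smul, map_smul, LinearMap.smul_apply] at e
    have m1 := h1 (k + l) ((superalgebra K n m).br01 g h) (bracket_mem_weightSpace hg hh)
    have m2 := bracket_mem_weightSpace hg (h1 l h hh)
    have m3 := bracket_mem_weightSpace hh (h0 k g hg)
    rw [add_comm l k] at m3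
    have m4 := sub_mem (sub_mem m2 m3) m1
    convert m4 using 1
    rw [← sub_eq_zero, ← neg_eq_zero, ← e]
    push_cast
    module
  · have e := d2_even_odd_odd _ hc (regular K n m) h h'
    rw [br01_regular hh, br01_regular hh', br11_eq_zero, superalgebra_bracket,
      map_smul, map_smul, map_zero, LinearMap.smul_apply, LinearMap.smul_apply,
      LinearMap.zero_apply, hc.1.2 h' h] at e
    have m2 := bracket_mem_weightSpace hh (h1 l h' hh')
    have m3 := bracket_mem_weightSpace hh' (h1 k h hh)
    rw [add_comm l k] at m3
    have m4 := add_mem m2 m3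
    convert m4 using 1
    rw [← sub_eq_zero, ← neg_eq_zero, ← e]
    push_cast
    module

/-- The linear map that multiplies the component from weight `l` to weight `k` of `G` by
`(l - k)⁻¹` if `l ≠ k` and by `0` if `l = k`. -/
noncomputable def weightHomotopy (G : Carrier K n m →ₗ[K] Carrier K n m) :
    Carrier K n m →ₗ[K] Carrier K n m :=
  Finsupp.linearCombination K fun a =>
    diag (fun k => ((weight a : K) - weight k)⁻¹) (G (Finsupp.single a 1))

theorem weightHomotopy_of_mem (G : Carrier K n m →ₗ[K] Carrier K n m) {l : ℕ}
    {v : Carrier K n m} (hv : v ∈ weightSpace K n m l) :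
    weightHomotopy G v = diag (fun k => ((l : K) - weight k)⁻¹) (G v) := by
  refine weightSpace_induction
    (p := fun v => weightHomotopy G v = diag (fun k => ((l : K) - weight k)⁻¹) (G v)) hv
    (by simp) (fun x y hx hy => by simp [hx, hy]) (fun r x hx => by simp [hx]) fun a ha => ?_
  simp [weightHomotopy, ha]

/-- Applying l − ad R after the diagonal operator multiplies the component of weight k by
(l−k)(l−k)⁻¹, that is by 1 for k ≠ l and by 0 for k = l. Only the component of weight l survives the
subtraction. -/
theorem sub_homotopy_mem_weightSpace [CharZero K] (l : ℕ) (w : Carrier K n m) :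
    w - ((l : K) • diag (fun k => ((l : K) - weight k)⁻¹) w
      - bracket K n m (regular K n m : Carrier K n m) (diag (fun k => ((l : K) - weight k)⁻¹) w))
      ∈ weightSpace K n m l := by
  rw [mem_weightSpace]
  intro a ha
  have h : (l : K) - weight a ≠ 0 := sub_ne_zero.2 (Nat.cast_injective.ne (Ne.symm ha))
  rw [bracket_regular]
  simp only [Finsupp.sub_apply, Finsupp.smul_apply, diag_apply, smul_eq_mul]
  field_simp
  ring

theorem regular_mem_weightSpace : (regular K n m : Carrier K n m) ∈ weightSpace K n m 0 :=
  torus_mem_weightSpace _ _ _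

/-- Every cocycle is cohomologous to one that adds weights. -/
theorem exists_preservesWeights [CharZero K] {c : (superalgebra K n m).PreCochain2}
    (hc : c ∈ (superalgebra K n m).Z2) :
    ∃ c' ∈ (superalgebra K n m).Z2, PreservesWeights c' ∧
      (c' ∈ (superalgebra K n m).B2 → c ∈ (superalgebra K n m).B2) := by
  -- `weightHomotopy` is defined through the basis of the whole space, so the contractions with R
  -- are first extended from the even and the odd part.
  obtain ⟨G, hG⟩ := LinearMap.exists_extend (c.1 (regular K n m))
  obtain ⟨H, hH⟩ := LinearMap.exists_extend (c.2.1 (regular K n m))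
  replace hG : ∀ g : (superalgebra K n m).Even, G g = c.1 (regular K n m) g :=
    fun g => LinearMap.congr_fun hG g
  replace hH : ∀ h : (superalgebra K n m).Odd, H h = c.2.1 (regular K n m) h :=
    fun h => LinearMap.congr_fun hH h
  -- Since c(R, R) = 0, the primitive f vanishes on R. This removes the term [g, f R], leaving df(R,
  -- g) = l f(g) − [R, f(g)] for g of weight l.
  have hr : weightHomotopy G (regular K n m : Carrier K n m) = 0 := by
    rw [weightHomotopy_of_mem G regular_mem_weightSpace, hG, hc.1.1, map_zero]
  obtain ⟨c', hc', h00, h01, hB⟩ := exists_sub_d1 _ two_ne_zero hc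
    (weightHomotopy G ∘ₗ Submodule.subtype _, weightHomotopy H ∘ₗ Submodule.subtype _)
  refine ⟨c', hc', preservesWeights_of_regular hc' (fun l g hg => ?_) (fun l h hh => ?_), hB⟩
  · have e := sub_homotopy_mem_weightSpace l (c.1 (regular K n m) g)
    rw [← hG, ← weightHomotopy_of_mem G hg] at e
    rw [h00, br00_regular hg, map_smul, ← hG, superalgebra_bracket]
    simpa [hr] using e
  · have e := sub_homotopy_mem_weightSpace l (c.2.1 (regular K n m) h)
    rw [← hH, ← weightHomotopy_of_mem H hh] at e
    rw [h01, br01_regular hh, map_smul, ← hH, superalgebra_bracket]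
    simpa [hr] using e

/-! ### Brackets of generators, and linear maps determined on a basis -/

/-- The vector `X_k` as an even element. -/
noncomputable def evenX (K : Type*) [Field K] (n m k : ℕ) : (superalgebra K n m).Even :=
  ⟨vecX K n m k, vecX_mem k⟩

/-- The vector `Y_k` as an odd element. -/
noncomputable def oddY (K : Type*) [Field K] (n m k : ℕ) : (superalgebra K n m).Odd :=
  ⟨vecY K n m k, vecY_mem k⟩

theorem evenX_one_mem_weightSpace : (evenX K n m 1 : Carrier K n m) ∈ weightSpace K n m 1 :=
  vecX_one_mem_weightSpace

theorem evenX_mem_weightSpace {k : ℕ} (hk : 2 ≤ k) :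
    (evenX K n m k : Carrier K n m) ∈ weightSpace K n m (k + step n m) :=
  vecX_mem_weightSpace hk

theorem oddY_mem_weightSpace (k : ℕ) :
    (oddY K n m k : Carrier K n m) ∈ weightSpace K n m (k + step n m ^ 2) :=
  vecY_mem_weightSpace k

theorem br00_coe (g g' : (superalgebra K n m).Even) :
    ((superalgebra K n m).br00 g g' : Carrier K n m) = bracket K n m g g' := rfl

theorem br01_coe (g : (superalgebra K n m).Even) (h : (superalgebra K n m).Odd) :
    ((superalgebra K n m).br01 g h : Carrier K n m) = bracket K n m g h := rfl

theorem br00_torus_X (p q r : K) (k : ℕ) :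
    (superalgebra K n m).br00 (torus p q r) (evenX K n m k)
      = (p * k + if 2 ≤ k then q else 0) • evenX K n m k :=
  Subtype.ext (bracket_torus_X p q r k)

theorem br01_torus_Y (p q r : K) (k : ℕ) :
    (superalgebra K n m).br01 (torus p q r) (oddY K n m k) = (p * k + r) • oddY K n m k :=
  Subtype.ext (bracket_torus_Y p q r k)

theorem bracket_X_one_X {k : ℕ} (hk : 2 ≤ k) :
    bracket K n m (vecX K n m 1) (vecX K n m k) = vecX K n m (k + 1) := by
  rw [bracket_X_X, if_pos ⟨rfl, hk⟩, if_neg (by omega), sub_zero]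

theorem bracket_X_one_Y {k : ℕ} (hn : 1 ≤ n) (hk : 1 ≤ k) :
    bracket K n m (vecX K n m 1) (vecY K n m k) = vecY K n m (k + 1) := by
  rw [bracket_X_Y _ _ hk, if_pos ⟨rfl, hn⟩]

theorem br00_X_one_X {k : ℕ} (hk : 2 ≤ k) :
    (superalgebra K n m).br00 (evenX K n m 1) (evenX K n m k) = evenX K n m (k + 1) :=
  Subtype.ext (bracket_X_one_X hk)

theorem br01_X_one_Y {k : ℕ} (hn : 1 ≤ n) (hk : 1 ≤ k) :
    (superalgebra K n m).br01 (evenX K n m 1) (oddY K n m k) = oddY K n m (k + 1) :=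
  Subtype.ext (bracket_X_one_Y hn hk)

theorem bracket_torus_torus (p q r p' q' r' : K) :
    bracket K n m (torus (n := n) (m := m) p q r : Carrier K n m)
      (torus (n := n) (m := m) p' q' r' : Carrier K n m) = 0 := by
  conv_lhs => rw [torus.eq_def p' q' r']
  simp only [map_add, map_smul, bracket_torus_T p q r _ (Or.inl rfl),
    bracket_torus_T p q r _ (Or.inr (Or.inl rfl)), bracket_torus_T p q r _ (Or.inr (Or.inr rfl))]
  simp

theorem br00_torus_torus (p q r p' q' r' : K) :
    (superalgebra K n m).br00 (torus p q r) (torus p' q' r') = 0 :=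
  Subtype.ext (bracket_torus_torus p q r p' q' r')

theorem torus_eq (p q r : K) : (torus p q r : (superalgebra K n m).Even)
    = p • torus 1 0 0 + q • torus 0 1 0 + r • torus 0 0 1 := by
  refine Subtype.ext ?_
  simp [torus]

/-- This allows the normalization to be checked at T₁, T₂, T₃ only, where the compensating torus
elements are prescribed; their choice for general p, q, r need not be linear. -/
theorem torus_linearMap_eq_zero {M : Type*} [AddCommMonoid M] [Module K M]
    {f : (superalgebra K n m).Even →ₗ[K] M} (h₁ : f (torus 1 0 0) = 0)
    (h₂ : f (torus 0 1 0) = 0) (h₃ : f (torus 0 0 1) = 0) (p q r : K) : f (torus p q r) = 0 := by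
  rw [torus_eq, map_add, map_add, map_smul, map_smul, map_smul, h₁, h₂, h₃]
  simp

theorem even_linearMap_eq_zero {M : Type*} [AddCommMonoid M] [Module K M]
    (f : (superalgebra K n m).Even →ₗ[K] M) (hX : ∀ k, 1 ≤ k → f (evenX K n m k) = 0)
    (hT : ∀ p q r, f (torus p q r) = 0) : f = 0 := by
  ext ⟨v, hv⟩
  -- Membership is packed into the predicate, so that the induction can run over vectors of the
  -- ambient space.
  obtain ⟨h, e⟩ : ∃ h : v ∈ (superalgebra K n m).part 0, f ⟨v, h⟩ = 0 := by
    refine part_induction (p := fun v => ∃ h : v ∈ (superalgebra K n m).part 0, f ⟨v, h⟩ = 0) hv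
      ⟨zero_mem _, f.map_zero⟩ ?_ ?_ fun a ha => ?_
    · rintro x y ⟨hx, ex⟩ ⟨hy, ey⟩
      exact ⟨add_mem hx hy, (f.map_add ⟨x, hx⟩ ⟨y, hy⟩).trans (by rw [ex, ey, add_zero])⟩
    · rintro r x ⟨hx, ex⟩
      exact ⟨Submodule.smul_mem _ r hx, (f.map_smul r ⟨x, hx⟩).trans (by rw [ex, smul_zero])⟩
    · have key : ∀ g : (superalgebra K n m).Even, (g : Carrier K n m) = Finsupp.single a 1 →
          f g = 0 → ∃ h : Finsupp.single a 1 ∈ (superalgebra K n m).part 0, f ⟨_, h⟩ = 0 := by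
        rintro ⟨g, hg⟩ rfl e
        exact ⟨hg, e⟩
      cases a with
      | X i => exact key (evenX K n m (i.val + 1)) (single_X i).symm (hX _ (by omega))
      | Y j => simp [parity] at ha
      | T1 => exact key (torus 1 0 0) (by simp [torus]) (hT _ _ _)
      | T2 => exact key (torus 0 1 0) (by simp [torus]) (hT _ _ _)
      | T3 => exact key (torus 0 0 1) (by simp [torus]) (hT _ _ _)
  exact e

theorem odd_linearMap_eq_zero {M : Type*} [AddCommMonoid M] [Module K M]
    (f : (superalgebra K n m).Odd →ₗ[K] M) (hY : ∀ k, 1 ≤ k → f (oddY K n m k) = 0) :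
    f = 0 := by
  ext ⟨v, hv⟩
  obtain ⟨h, e⟩ : ∃ h : v ∈ (superalgebra K n m).part 1, f ⟨v, h⟩ = 0 := by
    refine part_induction (p := fun v => ∃ h : v ∈ (superalgebra K n m).part 1, f ⟨v, h⟩ = 0) hv
      ⟨zero_mem _, f.map_zero⟩ ?_ ?_ fun a ha => ?_
    · rintro x y ⟨hx, ex⟩ ⟨hy, ey⟩
      exact ⟨add_mem hx hy, (f.map_add ⟨x, hx⟩ ⟨y, hy⟩).trans (by rw [ex, ey, add_zero])⟩
    · rintro r x ⟨hx, ex⟩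
      exact ⟨Submodule.smul_mem _ r hx, (f.map_smul r ⟨x, hx⟩).trans (by rw [ex, smul_zero])⟩
    · have key : ∀ g : (superalgebra K n m).Odd, (g : Carrier K n m) = Finsupp.single a 1 →
          f g = 0 → ∃ h : Finsupp.single a 1 ∈ (superalgebra K n m).part 1, f ⟨_, h⟩ = 0 := by
        rintro ⟨g, hg⟩ rfl e
        exact ⟨hg, e⟩
      cases a with
      | Y j => exact key (oddY K n m (j.val + 1)) (single_Y j).symm (hY _ (by omega))
      | _ => simp [parity] at ha
  exact e

/-! ### Vanishing of normalized cocycles -/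

/-- The cochain vanishes on the pairs `(X₁, X_k)`, `(X₁, Y_k)` and on the pairs of an element of
the torus and one of the generators `X₁`, `X₂`, `Y₁` of the nilradical. -/
structure IsNormalized (c : (superalgebra K n m).PreCochain2) : Prop where
  X_X : ∀ k, c.1 (evenX K n m 1) (evenX K n m k) = 0
  X_Y : ∀ k, 1 ≤ k → c.2.1 (evenX K n m 1) (oddY K n m k) = 0
  T_X_one : ∀ p q r, c.1 (torus p q r) (evenX K n m 1) = 0
  T_X_two : ∀ p q r, c.1 (torus p q r) (evenX K n m 2) = 0
  T_Y_one : ∀ p q r, c.2.1 (torus p q r) (oddY K n m 1) = 0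

theorem vecX_eq_zero {k : ℕ} (h : n < k) : vecX K n m k = 0 := by
  rw [vecX, dif_neg (by omega)]

theorem evenX_eq_zero {k : ℕ} (h : n < k) : evenX K n m k = 0 :=
  Subtype.ext (vecX_eq_zero h)

theorem vecX_ne_zero {k : ℕ} (h : 1 ≤ k ∧ k ≤ n) : vecX K n m k ≠ 0 := by
  rw [vecX, dif_pos h]
  simp

theorem vecY_ne_zero {k : ℕ} (h : 1 ≤ k ∧ k ≤ m) : vecY K n m k ≠ 0 := by
  rw [vecY, dif_pos h]
  simp

/-- In the cocycle identity on (t, X₁, X_k), normalization and the induction hypothesis kill every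
term except c(X_{k+1}, t). Vanishing thus spreads from X₂ along ad X₁; `T_Y_eq_zero` does the same
from Y₁. -/
theorem T_X_eq_zero {c : (superalgebra K n m).PreCochain2} (hc : c ∈ (superalgebra K n m).Z2)
    (hN : IsNormalized c) (p q r : K) {k : ℕ} (hk : 1 ≤ k) :
    c.1 (torus p q r) (evenX K n m k) = 0 := by
  obtain rfl | hk' : k = 1 ∨ 2 ≤ k := by omega
  · exact hN.T_X_one p q r
  clear hk
  induction k, hk' using Nat.le_induction with
  | base => exact hN.T_X_two p q r
  | succ k hk ih =>
    have e := d2_even_even_even _ hc (torus p q r) (evenX K n m 1) (evenX K n m k)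
    rw [br00_torus_X, br00_torus_X, br00_X_one_X hk, map_smul, map_smul, LinearMap.smul_apply,
      LinearMap.smul_apply, C2_swap _ hc.1 (evenX K n m k), hN.X_X, ih,
      hN.T_X_one, C2_swap _ hc.1 _ (torus p q r)] at e
    simpa using e

theorem T_Y_eq_zero {c : (superalgebra K n m).PreCochain2} (hc : c ∈ (superalgebra K n m).Z2)
    (hN : IsNormalized c) (hn : 1 ≤ n) (p q r : K) {k : ℕ} (hk : 1 ≤ k) :
    c.2.1 (torus p q r) (oddY K n m k) = 0 := by
  induction k, hk using Nat.le_induction with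
  | base => exact hN.T_Y_one p q r
  | succ k hk ih =>
    have e := d2_even_even_odd _ hc (torus p q r) (evenX K n m 1) (oddY K n m k)
    rw [br00_torus_X, br01_torus_Y, br01_X_one_Y hn hk, map_smul, map_smul, LinearMap.smul_apply,
      hN.X_Y k hk, ih, hN.T_X_one] at e
    simpa using e

/-- The value has weight 0, so it lies in the torus. The cocycle identity with X₁, X₂ or Y₁ as third
argument says that it commutes with that vector. The resulting equations u = 0, 2u + v = 0, u + w =
0 leave only zero. -/
theorem T_T_eq_zero {c : (superalgebra K n m).PreCochain2} (hc : c ∈ (superalgebra K n m).Z2)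
    (hN : IsNormalized c) (hW : PreservesWeights c) (hn : 2 ≤ n) (hm : 1 ≤ m)
    (p q r p' q' r' : K) : c.1 (torus p q r) (torus p' q' r') = 0 := by
  obtain ⟨u, v, w, hv⟩ := exists_eq_torus (hW.even_even 0 0 _ _ (torus_mem_weightSpace p q r)
    (torus_mem_weightSpace p' q' r'))
  have hX : ∀ k, 1 ≤ k →
      bracket K n m (torus (n := n) (m := m) u v w : Carrier K n m) (vecX K n m k) = 0 := by
    intro k hk
    have e := d2_even_even_even _ hc (torus p q r) (torus p' q' r') (evenX K n m k)
    rw [br00_torus_torus, br00_torus_X, br00_torus_X, map_smul, map_smul, LinearMap.smul_apply,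
      LinearMap.smul_apply, C2_swap _ hc.1 (evenX K n m k), C2_swap _ hc.1 (evenX K n m k),
      T_X_eq_zero hc hN _ _ _ hk, T_X_eq_zero hc hN _ _ _ hk, hv, superalgebra_bracket] at e
    rw [bracket_skew]
    simpa [evenX] using e
  have hY : bracket K n m (torus (n := n) (m := m) u v w : Carrier K n m) (vecY K n m 1) = 0 := by
    have e := d2_even_even_odd _ hc (torus p q r) (torus p' q' r') (oddY K n m 1)
    rw [br00_torus_torus, br01_torus_Y, br01_torus_Y, map_smul, map_smul,
      hN.T_Y_one, hN.T_Y_one, hv, superalgebra_bracket] at e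
    rw [bracket_skew]
    simpa [oddY] using e
  have h1 := hX 1 le_rfl
  have h2 := hX 2 (by omega)
  rw [bracket_torus_X, smul_eq_zero, or_iff_left (vecX_ne_zero (by omega))] at h1 h2
  rw [bracket_torus_Y, smul_eq_zero, or_iff_left (vecY_ne_zero (by omega))] at hY
  have hu : u = 0 := by simpa using h1
  have hv' : v = 0 := by simpa [hu] using h2
  have hw : w = 0 := by simpa [hu] using hY
  rw [hv, hu, hv', hw]
  simp [torus]

/-- A normalized cocycle that adds weights vanishes. -/
theorem eq_zero_of_isNormalized {c : (superalgebra K n m).PreCochain2}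
    (hc : c ∈ (superalgebra K n m).Z2) (hN : IsNormalized c) (hW : PreservesWeights c)
    (hn : 2 ≤ n) (hm : 1 ≤ m) : c = 0 := by
  have hs := step_sq (n := n) (m := m)
  have hs' : step n m = n + m + 6 := rfl
  have hXX : ∀ k l, 1 ≤ k → 1 ≤ l → c.1 (evenX K n m k) (evenX K n m l) = 0 := by
    intro k l hk hl
    obtain rfl | hk : k = 1 ∨ 2 ≤ k := by omega
    · exact hN.X_X l
    obtain rfl | hl : l = 1 ∨ 2 ≤ l := by omega
    · rw [C2_swap _ hc.1, hN.X_X, neg_zero]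
    -- Indices beyond n give the zero vector; setting them aside bounds k + l + 2N by N².
    by_cases hkn : n < k
    · simp [evenX_eq_zero hkn]
    by_cases hln : n < l
    · simp [evenX_eq_zero hln]
    exact eq_zero_of_mem_weightSpace
      (hW.even_even _ _ _ _ (evenX_mem_weightSpace hk) (evenX_mem_weightSpace hl)) (by omega)
      (by omega)
  have h00 : c.1 = 0 := by
    refine even_linearMap_eq_zero c.1 (fun k hk => ?_) fun p q r => ?_
    · refine even_linearMap_eq_zero (c.1 _) (fun l hl => hXX k l hk hl) fun p q r => ?_
      rw [C2_swap _ hc.1, T_X_eq_zero hc hN _ _ _ hk, neg_zero]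
    · exact even_linearMap_eq_zero _ (fun l hl => T_X_eq_zero hc hN _ _ _ hl)
        fun p' q' r' => T_T_eq_zero hc hN hW hn hm _ _ _ _ _ _
  have h01 : c.2.1 = 0 := by
    refine even_linearMap_eq_zero c.2.1 (fun k hk => ?_) fun p q r => ?_
    · refine odd_linearMap_eq_zero _ fun l hl => ?_
      obtain rfl | hk : k = 1 ∨ 2 ≤ k := by omega
      · exact hN.X_Y l hl
      by_cases hkn : n < k
      · simp [evenX_eq_zero hkn]
      -- The weight k + l + N + N² exceeds m + N², because N > m.
      exact eq_zero_of_mem_weightSpace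
        (hW.even_odd _ _ _ _ (evenX_mem_weightSpace hk) (oddY_mem_weightSpace l)) (by omega)
        (by omega)
    · exact odd_linearMap_eq_zero _ fun l hl => T_Y_eq_zero hc hN (by omega) _ _ _ hl
  have h11 : c.2.2 = 0 := by
    refine odd_linearMap_eq_zero _ fun k hk => odd_linearMap_eq_zero _ fun l hl => ?_
    exact eq_zero_of_mem_weightSpace
        (hW.odd_odd _ _ _ _ (oddY_mem_weightSpace k) (oddY_mem_weightSpace l)) (by omega)
        (by omega)
  exact Prod.ext h00 (Prod.ext h01 h11)

/-! ### Normalization of weight-adding cocycles -/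

/-- The linear map with eigenvalue `β k` on `X_k`, with eigenvalue `γ k` on `Y_k`, and with the
values `t₁, t₂, t₃` on `T₁, T₂, T₃`. -/
noncomputable def blockMap (β γ : ℕ → K) (t₁ t₂ t₃ : Carrier K n m) :
    Carrier K n m →ₗ[K] Carrier K n m :=
  Finsupp.linearCombination K fun
    | .X i => β (i.val + 1) • vecX K n m (i.val + 1)
    | .Y j => γ (j.val + 1) • vecY K n m (j.val + 1)
    | .T1 => t₁
    | .T2 => t₂
    | .T3 => t₃

section blockMap

variable (β γ : ℕ → K) (t₁ t₂ t₃ : Carrier K n m)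

theorem blockMap_X (k : ℕ) : blockMap β γ t₁ t₂ t₃ (vecX K n m k) = β k • vecX K n m k := by
  by_cases h : 1 ≤ k ∧ k ≤ n
  · obtain ⟨k, rfl⟩ : ∃ j, k = j + 1 := ⟨k - 1, by omega⟩
    have h2 := single_X (K := K) (m := m) (⟨k, by omega⟩ : Fin n)
    simp only at h2
    rw [← h2, blockMap, Finsupp.linearCombination_single, one_smul, h2]
  · simp [vecX, h]

theorem blockMap_Y (k : ℕ) : blockMap β γ t₁ t₂ t₃ (vecY K n m k) = γ k • vecY K n m k := by
  by_cases h : 1 ≤ k ∧ k ≤ m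
  · obtain ⟨k, rfl⟩ : ∃ j, k = j + 1 := ⟨k - 1, by omega⟩
    have h2 := single_Y (K := K) (n := n) (⟨k, by omega⟩ : Fin m)
    simp only at h2
    rw [← h2, blockMap, Finsupp.linearCombination_single, one_smul, h2]
  · simp [vecY, h]

theorem blockMap_torus (p q r : K) :
    blockMap β γ t₁ t₂ t₃ (torus (n := n) (m := m) p q r : Carrier K n m)
      = p • t₁ + q • t₂ + r • t₃ := by
  simp [blockMap, torus]

theorem blockMap_mem_weightSpace (h₁ : t₁ ∈ weightSpace K n m 0) (h₂ : t₂ ∈ weightSpace K n m 0)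
    (h₃ : t₃ ∈ weightSpace K n m 0) {k : ℕ} {v : Carrier K n m} (hv : v ∈ weightSpace K n m k) :
    blockMap β γ t₁ t₂ t₃ v ∈ weightSpace K n m k := by
  refine weightSpace_induction (p := fun v => blockMap β γ t₁ t₂ t₃ v ∈ weightSpace K n m k) hv
    (by simp) (fun x y hx hy => by simpa using add_mem hx hy)
    (fun r x hx => by simpa using Submodule.smul_mem _ r hx) fun a ha => ?_
  have hs : Finsupp.single a 1 ∈ weightSpace K n m k := Finsupp.single_mem_supported K 1 ha
  cases a with
  | X i => rw [single_X] at hs ⊢; rw [blockMap_X]; exact Submodule.smul_mem _ _ hs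
  | Y j => rw [single_Y] at hs ⊢; rw [blockMap_Y]; exact Submodule.smul_mem _ _ hs
  | T1 => obtain rfl : 0 = k := ha; simpa [blockMap] using h₁
  | T2 => obtain rfl : 0 = k := ha; simpa [blockMap] using h₂
  | T3 => obtain rfl : 0 = k := ha; simpa [blockMap] using h₃

variable {t₁ t₂ t₃}

theorem exists_blockMap (h₁ : t₁ ∈ weightSpace K n m 0) (h₂ : t₂ ∈ weightSpace K n m 0)
    (h₃ : t₃ ∈ weightSpace K n m 0) : ∃ F : Carrier K n m →ₗ[K] Carrier K n m,
      (∀ k, F (vecX K n m k) = β k • vecX K n m k) ∧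
      (∀ k, F (vecY K n m k) = γ k • vecY K n m k) ∧
      (∀ p q r : K, F (torus (n := n) (m := m) p q r : Carrier K n m)
        = p • t₁ + q • t₂ + r • t₃) ∧
      ∀ (k : ℕ) (v : Carrier K n m), v ∈ weightSpace K n m k → F v ∈ weightSpace K n m k :=
  ⟨blockMap β γ t₁ t₂ t₃, blockMap_X _ _ _ _ _, blockMap_Y _ _ _ _ _,
    blockMap_torus _ _ _ _ _, fun _ _ => blockMap_mem_weightSpace _ _ _ _ _ h₁ h₂ h₃⟩

end blockMap

/-- The values of a weight-adding cochain on a torus element and the generators of the nilradical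
are those of the adjoint action of another torus element. -/
theorem exists_torus_compensating {c : (superalgebra K n m).PreCochain2}
    (hW : PreservesWeights c) (hn : 2 ≤ n) (p q r : K) :
    ∃ p' q' r' : K,
      c.1 (torus p q r) (evenX K n m 1)
        = bracket K n m (vecX K n m 1) (torus (n := n) (m := m) p' q' r' : Carrier K n m) ∧
      c.1 (torus p q r) (evenX K n m 2)
        = bracket K n m (vecX K n m 2) (torus (n := n) (m := m) p' q' r' : Carrier K n m) ∧
      c.2.1 (torus p q r) (oddY K n m 1)
        = bracket K n m (vecY K n m 1) (torus (n := n) (m := m) p' q' r' : Carrier K n m) := by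
  have h1 := hW.even_even 0 1 _ _ (torus_mem_weightSpace p q r) evenX_one_mem_weightSpace
  have h2 := hW.even_even 0 _ _ _ (torus_mem_weightSpace p q r) (evenX_mem_weightSpace le_rfl)
  have h3 := hW.even_odd 0 _ _ _ (torus_mem_weightSpace p q r) (oddY_mem_weightSpace 1)
  rw [zero_add] at h1 h2 h3
  obtain ⟨a, ha⟩ := exists_eq_smul_vecX_one h1
  obtain ⟨b, hb⟩ := exists_eq_smul_vecX le_rfl (by omega) h2
  obtain ⟨d, hd⟩ := exists_eq_smul_vecY h3
  -- For t' = p'T₁ + q'T₂ + r'T₃, the brackets of X₁, X₂, Y₁ with t' have coefficients −p', −(2p' +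
  -- q'), −(p' + r'). Equating these with a, b, d gives a triangular system.
  refine ⟨-a, -b + 2 * a, -d + a, ?_, ?_, ?_⟩
  · rw [bracket_skew, bracket_torus_X]; exact ha.trans (by simp)
  · rw [bracket_skew, bracket_torus_X, ← neg_smul]
    refine hb.trans ?_
    congr 1; push_cast; simp; ring
  · rw [bracket_skew, bracket_torus_Y, ← neg_smul]
    refine hd.trans ?_
    congr 1; push_cast; ring

/-- Every weight-adding cocycle is cohomologous to a normalized one. -/
theorem exists_isNormalized [CharZero K] {c : (superalgebra K n m).PreCochain2}
    (hc : c ∈ (superalgebra K n m).Z2) (hW : PreservesWeights c) (hn : 2 ≤ n) :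
    ∃ c' ∈ (superalgebra K n m).Z2, PreservesWeights c' ∧ IsNormalized c' ∧
      (c' ∈ (superalgebra K n m).B2 → c ∈ (superalgebra K n m).B2) := by
  have hX : ∀ k, ∃ a : K, 2 ≤ k →
      c.1 (evenX K n m 1) (evenX K n m k) = a • vecX K n m (k + 1) := by
    intro k
    by_cases hk : 2 ≤ k
    · by_cases hkn : n < k
      · exact ⟨0, fun _ => by simp [evenX_eq_zero hkn]⟩
      · have h := hW.even_even 1 _ _ _ evenX_one_mem_weightSpace (evenX_mem_weightSpace hk)
        rw [← add_assoc, add_comm 1 k] at h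
        obtain ⟨a, ha⟩ := exists_eq_smul_vecX (by omega) (by omega) h
        exact ⟨a, fun _ => ha⟩
    · exact ⟨0, fun h => absurd h hk⟩
  have hY : ∀ k, ∃ b : K, c.2.1 (evenX K n m 1) (oddY K n m k) = b • vecY K n m (k + 1) := by
    intro k
    have h := hW.even_odd 1 _ _ _ evenX_one_mem_weightSpace (oddY_mem_weightSpace k)
    rw [← add_assoc, add_comm 1 k] at h
    exact exists_eq_smul_vecY h
  choose a ha using hX
  choose b hb using hY
  choose tp tq tr h1 h2 h3 using exists_torus_compensating hW hn
  obtain ⟨t, htd⟩ : ∃ t : K → K → K → Carrier K n m, ∀ p q r,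
      t p q r = torus (n := n) (m := m) (tp p q r) (tq p q r) (tr p q r) :=
    ⟨_, fun _ _ _ => rfl⟩
  have ht : ∀ p q r, t p q r ∈ weightSpace K n m 0 := fun p q r => by
    rw [htd]; exact torus_mem_weightSpace _ _ _
  -- For diagonal F with β 1 = 0, dF(X₁, X_k) = (β(k+1) − β k) X_{k+1}, and likewise on Y_k with γ.
  -- So β and γ must have differences a and b. The empty sums give β 1 = β 2 = γ 1 = 0.
  obtain ⟨β, hβ⟩ : ∃ β : ℕ → K, ∀ k, β k = ∑ i ∈ Finset.Ico 2 k, a i := ⟨_, fun _ => rfl⟩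
  obtain ⟨γ, hγ⟩ : ∃ γ : ℕ → K, ∀ k, γ k = ∑ i ∈ Finset.Ico 1 k, b i := ⟨_, fun _ => rfl⟩
  have hβ1 : β 1 = 0 := by simp [hβ]
  have hβ2 : β 2 = 0 := by simp [hβ]
  have hγ1 : γ 1 = 0 := by simp [hγ]
  obtain ⟨F, FX, FY, FT, FW⟩ : ∃ F : Carrier K n m →ₗ[K] Carrier K n m,
      (∀ k, F (vecX K n m k) = β k • vecX K n m k) ∧
      (∀ k, F (vecY K n m k) = γ k • vecY K n m k) ∧
      (∀ p q r : K, F (torus (n := n) (m := m) p q r : Carrier K n m)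
        = p • t 1 0 0 + q • t 0 1 0 + r • t 0 0 1) ∧
      ∀ (k : ℕ) (v : Carrier K n m), v ∈ weightSpace K n m k → F v ∈ weightSpace K n m k :=
    exists_blockMap β γ (ht 1 0 0) (ht 0 1 0) (ht 0 0 1)
  obtain ⟨c', hc', h00, h01, hB⟩ := exists_sub_d1 _ two_ne_zero hc
    (F ∘ₗ Submodule.subtype _, F ∘ₗ Submodule.subtype _)
  simp only [LinearMap.comp_apply, Submodule.subtype_apply, superalgebra_bracket, br00_coe,
    br01_coe] at h00 h01
  refine ⟨c', hc', preservesWeights_of_regular hc' (fun l g hg => ?_) (fun l h hh => ?_), ?_, hB⟩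
  -- F preserves weights, so F[R, g] and [R, F g] cancel. The correction reduces to [g, F R], which
  -- has the weight of g because F R lies in weight 0.
  · rw [h00, bracket_regular_of_mem hg, bracket_regular_of_mem (FW _ _ hg), map_smul]
    have m1 := hW.even_even 0 l _ _ regular_mem_weightSpace hg
    have m2 := bracket_mem_weightSpace hg (FW _ _ regular_mem_weightSpace)
    rw [zero_add] at m1
    simpa using sub_mem m1 m2
  · rw [h01, bracket_regular_of_mem hh, bracket_regular_of_mem (FW _ _ hh), map_smul]
    have m1 := hW.even_odd 0 l _ _ regular_mem_weightSpace hh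
    have m2 := bracket_mem_weightSpace hh (FW _ _ regular_mem_weightSpace)
    rw [zero_add] at m1
    simpa using sub_mem m1 m2
  · have hF1 : F (torus (K := K) (n := n) (m := m) 1 0 0 : Carrier K n m) = t 1 0 0 := by simp [FT]
    have hF2 : F (torus (K := K) (n := n) (m := m) 0 1 0 : Carrier K n m) = t 0 1 0 := by simp [FT]
    have hF3 : F (torus (K := K) (n := n) (m := m) 0 0 1 : Carrier K n m) = t 0 0 1 := by simp [FT]
    -- F is diagonal on the nilradical, so dF(t, X₁) = [X₁, F t]. When F takes the compensating
    -- value at t, this is exactly c(t, X₁). The same argument serves X₂ and Y₁.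
    have X1 : ∀ p q r : K, F (torus (n := n) (m := m) p q r : Carrier K n m) = t p q r →
        c'.1 (torus p q r) (evenX K n m 1) = 0 := by
      intro p q r e
      rw [h00, e, h1, ← htd]
      simp only [evenX, bracket_torus_X, map_smul, FX, hβ1]
      simp
    have X2 : ∀ p q r : K, F (torus (n := n) (m := m) p q r : Carrier K n m) = t p q r →
        c'.1 (torus p q r) (evenX K n m 2) = 0 := by
      intro p q r e
      rw [h00, e, h2, ← htd]
      simp only [evenX, bracket_torus_X, map_smul, FX, hβ2]
      simp
    have Y1 : ∀ p q r : K, F (torus (n := n) (m := m) p q r : Carrier K n m) = t p q r →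
        c'.2.1 (torus p q r) (oddY K n m 1) = 0 := by
      intro p q r e
      rw [h01, e, h3, ← htd]
      simp only [oddY, bracket_torus_Y, map_smul, FY, hγ1]
      simp
    refine ⟨fun k => ?_, fun k hk => ?_, ?_, ?_, ?_⟩
    · obtain rfl | rfl | hk : k = 0 ∨ k = 1 ∨ 2 ≤ k := by omega
      · have : evenX K n m 0 = 0 := Subtype.ext (by simp [evenX, vecX])
        rw [this, map_zero]
      · exact hc'.1.1 _
      · rw [h00, ha k hk]
        simp only [evenX, bracket_X_one_X hk, map_smul, FX, hβ1]
        have : β (k + 1) = β k + a k := by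
          rw [hβ, hβ, Finset.sum_Ico_succ_top hk]
        rw [this, zero_smul]
        module
    · rw [h01, hb k]
      simp only [evenX, oddY, bracket_X_one_Y (by omega : 1 ≤ n) hk, map_smul, FX, FY, hβ1]
      have : γ (k + 1) = γ k + b k := by
        rw [hγ, hγ, Finset.sum_Ico_succ_top hk]
      rw [this, zero_smul]
      module
    · exact torus_linearMap_eq_zero (f := c'.1.flip _) (X1 _ _ _ hF1) (X1 _ _ _ hF2)
        (X1 _ _ _ hF3)
    · exact torus_linearMap_eq_zero (f := c'.1.flip _) (X2 _ _ _ hF1) (X2 _ _ _ hF2)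
        (X2 _ _ _ hF3)
    · exact torus_linearMap_eq_zero (f := c'.2.1.flip _) (Y1 _ _ _ hF1) (Y1 _ _ _ hF2)
        (Y1 _ _ _ hF3)

/-- Every 2-cocycle of `SL^{n,m}` with adjoint coefficients is a coboundary. -/
theorem Z2_le_B2 [CharZero K] (hn : 2 ≤ n) (hm : 1 ≤ m) :
    (superalgebra K n m).Z2 ≤ (superalgebra K n m).B2 := by
  intro c hc
  obtain ⟨c₁, hc₁, hW₁, h₁⟩ := exists_preservesWeights hc
  obtain ⟨c₂, hc₂, hW₂, hN, h₂⟩ := exists_isNormalized hc₁ hW₁ hn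
  refine h₁ (h₂ ?_)
  rw [eq_zero_of_isNormalized hc₂ hN hW₂ hn hm]
  exact zero_mem _

end SL

theorem theorem4p1 {K : Type*} [Field K] [CharZero K] (n m : ℕ) (hn : 2 ≤ n) (hm : 1 ≤ m) :
    Module.rank K (SL.superalgebra K n m).H2
        = Module.rank K ((SL.superalgebra K n m).H2p 0)
          + Module.rank K ((SL.superalgebra K n m).H2p 1) ∧
      Module.rank K (SL.superalgebra K n m).H2 = 0 := by
  obtain ⟨h, hp⟩ := (SL.superalgebra K n m).rank_H2_eq_zero two_ne_zero (SL.Z2_le_B2 hn hm)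
  exact ⟨by rw [h, hp, hp, add_zero], h⟩
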